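/- Let $k$ be a field (for instance algebraically closed of characteristic zero), let $n\ge 0$, let $q_{ij}\in k^\times$ $(1\le i,j\le n)$ satisfy $q_{ii}=1$ and $q_{ij}q_{ji}=1$ for $i\ne j$, and let $\gamma_1,\dots,\gamma_n\in k^\times$. The quantized Weyl algebra $A=A_n^{q,\gamma}(k)$ is the $k$-algebra generated by $x_1,y_1,\dots,x_n,y_n$ subject to the relations $$y_iy_j=q_{ij}y_jy_i\ (\text{all } i,j),\qquad x_ix_j=\gamma_iq_{ij}x_jx_i\ (i<j),$$ $$x_iy_j=q_{ji}y_jx_i\ (i<j),\qquad x_iy_j=\gamma_jq_{ji}y_jx_i\ (i>j),$$ $$x_jy_j=1+\gamma_jy_jx_j+\sum_{l<j}(\gamma_l-1)y_lx_l\ (\text{all } j).$$ Let $\mathcal F$ be the filtration of $A$ with $\deg x_i=\deg y_i=i$, that is, $\mathcal F_m$ is spanned by the products of generators of total degree at most $m$. Definition. Let $A$ be a $k$-algebra with an exhaustive $\mathbb N$-filtration $\mathcal F$, let $D$ be a finitely generated subring of $k$, and let $A_D$ be a $D$-subalgebra of $A$ with the induced filtration $A_D\cap\mathcal F_i$. An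 order of a $k$-algebra $R$ is a $D$-subalgebra $R_D$ that is free over $D$ and such that the natural map $R_D\otimes_D k\to R$ is an isomorphism. The filtered algebra $A$ is congenial by means of $D$ and $A_D$ if: 1. every $\mathcal F_i$ is a finite-dimensional $k$-vector space; 2. $A_D$ is an order of $A$, and every $A_D\cap\mathcal F_i$ is a finitely generated $D$-module; 3. the canonical map $\operatorname{gr}_{\mathcal F}A_D\to\operatorname{gr}_{\mathcal F}A$ makes $\operatorname{gr}_{\mathcal F}A_D$ an order of $\operatorname{gr}_{\mathcal F}A$; 4. every graded piece of $\operatorname{gr}_{\mathcal F}A_D$ is a finitely generated $D$-module, and $\operatorname{gr}_{\mathcal F}A_D\otimes_D C$ is (left and right) noetherian for every commutative noetherian $D$-algebra $C$; 5. for every factor ring $F$ of $D$ that is a finite field, $A_D\otimes_D F$ is a finitely generated, (left and right) noetherian $F$-algebra that satisfies a polynomial identity. It is congenial if such $D$ and $A_D$ exist. Theorem. The quantized Weyl algebra $A=A_n^{q,\gamma}(k)$ with the filtration $\mathcal F$ is congenial. More precisely, let $D$ be the subring of $k$ generated by all $q_{ij}$, $\gamma_i$ and $\gamma_i^{-1}$,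 and let $A_D$ be the $D$-subalgebra of $A$ generated by $x_1,y_1,\dots,x_n,y_n$. Then $A$ is congenial by means of $D$ and $A_D$; in particular the reductions $A_D\otimes_D F$ to finite fields are PI. Moreover, the associated graded rings are quantum affine spaces: there are units $p_{cd}\in D^\times$, indexed by pairs $c,d$ of the $2n$ generators, with $p_{cc}=1$ and $p_{cd}p_{dc}=1$, such that $\operatorname{gr}_{\mathcal F}A_D$ (respectively $\operatorname{gr}_{\mathcal F}A$) is isomorphic to the $D$-algebra (respectively $k$-algebra) generated by $2n$ elements $z_c$ subject to $z_cz_d=p_{cd}z_dz_c$, with $z_c$ corresponding to the class, in degree $i$, of the generator $c\in\{x_i,y_i\}$. -/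

import Mathlib

open scoped TensorProduct DirectSum

noncomputable section

/-! ### Filtered algebras and associated graded algebras -/

/-- An exhaustive `ℕ`-filtration of an `R`-algebra `A` by `R`-submodules
`A₀ ⊆ A₁ ⊆ A₂ ⊆ ⋯` with `1 ∈ A₀` and `Aᵢ Aⱼ ⊆ Aᵢ₊ⱼ`. -/
structure AlgFiltration (R A : Type*) [CommRing R] [Ring A] [Algebra R A] where
  obj : ℕ → Submodule R A
  mono : Monotone obj
  one_mem : (1 : A) ∈ obj 0
  mul_mem : ∀ {i j : ℕ} {a b : A}, a ∈ obj i → b ∈ obj j → a * b ∈ obj (i + j)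
  exhaustive : ∀ a : A, ∃ i, a ∈ obj i

namespace AlgFiltration

section Graded

variable {R A : Type*} [CommRing R] [Ring A] [Algebra R A] (F : AlgFiltration R A)

/-- A filtration is locally finite if each of its terms is a finitely generated module. -/
def IsLocallyFinite : Prop := ∀ i, Module.Finite R (F.obj i)

/-- The preceding term of the filtration, with the convention `A₋₁ = 0`. -/
def below : ℕ → Submodule R A
  | 0 => ⊥
  | i + 1 => F.obj i

theorem mul_mem_below_left {i j : ℕ} {a b : A} (ha : a ∈ F.below i) (hb : b ∈ F.obj j) :
    a * b ∈ F.below (i + j) := by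
  cases i with
  | zero =>
    have h0 : a = 0 := by simpa [below] using ha
    simp [h0]
  | succ i =>
    rw [Nat.succ_add]
    exact F.mul_mem ha hb

theorem mul_mem_below_right {i j : ℕ} {a b : A} (ha : a ∈ F.obj i) (hb : b ∈ F.below j) :
    a * b ∈ F.below (i + j) := by
  cases j with
  | zero =>
    have h0 : b = 0 := by simpa [below] using hb
    simp [h0]
  | succ j => exact F.mul_mem ha hb

/-- The `i`-th graded piece `Aᵢ / Aᵢ₋₁`. -/
def Piece (i : ℕ) : Type _ := F.obj i ⧸ (F.below i).submoduleOf (F.obj i)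

instance (i : ℕ) : AddCommGroup (F.Piece i) :=
  inferInstanceAs (AddCommGroup (F.obj i ⧸ (F.below i).submoduleOf (F.obj i)))

instance {S : Type*} [CommRing S] [Algebra S R] [Algebra S A] [IsScalarTower S R A] (i : ℕ) :
    Module S (F.Piece i) :=
  inferInstanceAs (Module S (F.obj i ⧸ (F.below i).submoduleOf (F.obj i)))

instance {S : Type*} [CommRing S] [Algebra S R] [Algebra S A] [IsScalarTower S R A] (i : ℕ) :
    IsScalarTower S R (F.Piece i) :=
  inferInstanceAs (IsScalarTower S R (F.obj i ⧸ (F.below i).submoduleOf (F.obj i)))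

/-- The class of an element of `Aᵢ` in `Aᵢ / Aᵢ₋₁`. -/
def cls (i : ℕ) (a : A) (ha : a ∈ F.obj i) : F.Piece i :=
  Submodule.Quotient.mk ⟨a, ha⟩

theorem cls_surj {i : ℕ} (p : F.Piece i) : ∃ a, ∃ ha : a ∈ F.obj i, F.cls i a ha = p := by
  induction p using Submodule.Quotient.induction_on with
  | H x => exact ⟨x.1, x.2, rfl⟩

theorem cls_eq_cls {i : ℕ} {a b : A} {ha : a ∈ F.obj i} {hb : b ∈ F.obj i} :
    F.cls i a ha = F.cls i b hb ↔ a - b ∈ F.below i :=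
  Submodule.Quotient.eq _

theorem cls_add {i : ℕ} {a b : A} (ha : a ∈ F.obj i) (hb : b ∈ F.obj i) :
    F.cls i (a + b) (add_mem ha hb) = F.cls i a ha + F.cls i b hb := rfl

theorem cls_zero (i : ℕ) : F.cls i 0 (zero_mem _) = 0 := rfl

/-- The product `Aᵢ / Aᵢ₋₁ × Aⱼ / Aⱼ₋₁ → Aᵢ₊ⱼ / Aᵢ₊ⱼ₋₁` induced by that of `A`. -/
def pieceMul {i j : ℕ} (p : F.Piece i) (r : F.Piece j) : F.Piece (i + j) :=
  Quotient.liftOn₂' p r (fun a b => F.cls (i + j) (a.1 * b.1) (F.mul_mem a.2 b.2)) (by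
    intro a b a' b' ha hb
    rw [Submodule.quotientRel_def] at ha hb
    rw [cls_eq_cls]
    have h : a.1 * b.1 - a'.1 * b'.1 = (a.1 - a'.1) * b.1 + a'.1 * (b.1 - b'.1) := by
      noncomm_ring
    rw [h]
    exact add_mem (F.mul_mem_below_left ha b.2) (F.mul_mem_below_right a'.2 hb))

theorem pieceMul_cls {i j : ℕ} {a b : A} (ha : a ∈ F.obj i) (hb : b ∈ F.obj j) :
    F.pieceMul (F.cls i a ha) (F.cls j b hb) = F.cls (i + j) (a * b) (F.mul_mem ha hb) := rfl

theorem mk_cls_congr {i j : ℕ} {a b : A} (ha : a ∈ F.obj i) (hb : b ∈ F.obj j)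
    (hij : i = j) (hab : a = b) :
    GradedMonoid.mk (A := F.Piece) i (F.cls i a ha) = GradedMonoid.mk j (F.cls j b hb) := by
  subst hij hab; rfl

instance : GradedMonoid.GOne F.Piece := ⟨F.cls 0 1 F.one_mem⟩

instance : GradedMonoid.GMul F.Piece := ⟨fun p r => F.pieceMul p r⟩

theorem gone_eq : (GradedMonoid.GOne.one : F.Piece 0) = F.cls 0 1 F.one_mem := rfl

theorem gmul_cls {i j : ℕ} {a b : A} (ha : a ∈ F.obj i) (hb : b ∈ F.obj j) :
    GradedMonoid.GMul.mul (F.cls i a ha) (F.cls j b hb) =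
      F.cls (i + j) (a * b) (F.mul_mem ha hb) := rfl

instance : GradedMonoid.GMonoid F.Piece where
  one_mul := by
    rintro ⟨i, p⟩
    obtain ⟨a, ha, rfl⟩ := F.cls_surj p
    exact F.mk_cls_congr (F.mul_mem F.one_mem ha) ha (zero_add i) (one_mul a)
  mul_one := by
    rintro ⟨i, p⟩
    obtain ⟨a, ha, rfl⟩ := F.cls_surj p
    exact F.mk_cls_congr (F.mul_mem ha F.one_mem) ha (add_zero i) (mul_one a)
  mul_assoc := by
    rintro ⟨i, p⟩ ⟨j, r⟩ ⟨l, s⟩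
    obtain ⟨a, ha, rfl⟩ := F.cls_surj p
    obtain ⟨b, hb, rfl⟩ := F.cls_surj r
    obtain ⟨c, hc, rfl⟩ := F.cls_surj s
    exact F.mk_cls_congr (F.mul_mem (F.mul_mem ha hb) hc) (F.mul_mem ha (F.mul_mem hb hc))
      (add_assoc i j l) (mul_assoc a b c)

theorem intCast_mem (m : ℤ) : (m : A) ∈ F.obj 0 := by
  have h := (F.obj 0).smul_mem (m : R) F.one_mem
  rwa [Algebra.smul_def, mul_one, map_intCast] at h

theorem natCast_mem (m : ℕ) : (m : A) ∈ F.obj 0 := by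
  have h := F.intCast_mem m
  rwa [Int.cast_natCast] at h

theorem cls_congr {i : ℕ} {a b : A} (ha : a ∈ F.obj i) (hb : b ∈ F.obj i) (hab : a = b) :
    F.cls i a ha = F.cls i b hb := by
  subst hab; rfl

instance : DirectSum.GRing F.Piece where
  mul_zero := by
    intro i j p
    obtain ⟨a, ha, rfl⟩ := F.cls_surj p
    exact F.cls_congr (F.mul_mem ha (zero_mem _)) (zero_mem _) (mul_zero a)
  zero_mul := by
    intro i j p
    obtain ⟨a, ha, rfl⟩ := F.cls_surj p
    exact F.cls_congr (F.mul_mem (zero_mem _) ha) (zero_mem _) (zero_mul a)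
  mul_add := by
    intro i j p r s
    obtain ⟨a, ha, rfl⟩ := F.cls_surj p
    obtain ⟨b, hb, rfl⟩ := F.cls_surj r
    obtain ⟨c, hc, rfl⟩ := F.cls_surj s
    exact F.cls_congr (F.mul_mem ha (add_mem hb hc))
      (add_mem (F.mul_mem ha hb) (F.mul_mem ha hc)) (mul_add a b c)
  add_mul := by
    intro i j p r s
    obtain ⟨a, ha, rfl⟩ := F.cls_surj p
    obtain ⟨b, hb, rfl⟩ := F.cls_surj r
    obtain ⟨c, hc, rfl⟩ := F.cls_surj s
    exact F.cls_congr (F.mul_mem (add_mem ha hb) hc)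
      (add_mem (F.mul_mem ha hc) (F.mul_mem hb hc)) (add_mul a b c)
  natCast m := F.cls 0 m (F.natCast_mem m)
  natCast_zero := F.cls_congr _ (zero_mem _) Nat.cast_zero
  natCast_succ m := F.cls_congr _ (add_mem (F.natCast_mem m) F.one_mem) (Nat.cast_succ m)
  intCast m := F.cls 0 m (F.intCast_mem m)
  intCast_ofNat m := F.cls_congr _ _ (Int.cast_natCast m)
  intCast_negSucc_ofNat m :=
    F.cls_congr _ (neg_mem (F.natCast_mem (m + 1))) (Int.cast_negSucc m)

section Scalars

variable {S : Type*} [CommRing S] [Algebra S R] [Algebra S A] [IsScalarTower S R A]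

theorem algebraMap_mem (s : S) : algebraMap S A s ∈ F.obj 0 := by
  have h := (F.obj 0).smul_mem (algebraMap S R s) F.one_mem
  rwa [algebraMap_smul, ← Algebra.algebraMap_eq_smul_one] at h

theorem smul_mem_obj {i : ℕ} (s : S) {a : A} (ha : a ∈ F.obj i) : s • a ∈ F.obj i := by
  have h := (F.obj i).smul_mem (algebraMap S R s) ha
  rwa [algebraMap_smul] at h

theorem smul_cls {i : ℕ} (s : S) {a : A} (ha : a ∈ F.obj i) :
    s • F.cls i a ha = F.cls i (s • a) (F.smul_mem_obj s ha) := rfl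

/-- The associated graded ring is an algebra over `R`, and more generally over every commutative
ring `S` over which `R` is an algebra. -/
instance : DirectSum.GAlgebra S F.Piece where
  toFun :=
    { toFun := fun s => F.cls 0 (algebraMap S A s) (F.algebraMap_mem s)
      map_zero' := F.cls_congr _ (zero_mem _) (map_zero _)
      map_add' := fun s t =>
        F.cls_congr _ (add_mem (F.algebraMap_mem s) (F.algebraMap_mem t)) (map_add _ s t) }
  map_one := F.cls_congr _ _ (map_one _)
  map_mul s t :=
    F.mk_cls_congr _ (F.mul_mem (F.algebraMap_mem s) (F.algebraMap_mem t)) rfl (map_mul _ s t)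
  commutes := by
    rintro s ⟨i, p⟩
    obtain ⟨a, ha, rfl⟩ := F.cls_surj p
    exact F.mk_cls_congr (F.mul_mem (F.algebraMap_mem s) ha) (F.mul_mem ha (F.algebraMap_mem s))
      (by omega) (Algebra.commutes s a)
  smul_def := by
    rintro s ⟨i, p⟩
    obtain ⟨a, ha, rfl⟩ := F.cls_surj p
    exact F.mk_cls_congr (F.smul_mem_obj s ha) (F.mul_mem (F.algebraMap_mem s) ha)
      (by omega) (Algebra.smul_def s a)

end Scalars

/-- The associated graded ring `gr A = ⨁ᵢ Aᵢ / Aᵢ₋₁`. -/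
abbrev Gr : Type _ := ⨁ i, F.Piece i

/-- The class of `a ∈ Aᵢ` in the degree `i` part of `gr A`. -/
def symbol (i : ℕ) (a : A) (ha : a ∈ F.obj i) : F.Gr :=
  DirectSum.of F.Piece i (F.cls i a ha)

instance {S : Type*} [CommRing S] [Algebra S R] [Algebra S A] [IsScalarTower S R A] :
    IsScalarTower S R F.Gr where
  smul_assoc s r x := by
    ext i
    simp only [DirectSum.smul_apply, smul_assoc]

end Graded

section Induced

variable {D K A : Type*} [CommRing D] [CommRing K] [Ring A] [Algebra D K] [Algebra K A]
  [Algebra D A] [IsScalarTower D K A]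

/-- The filtration `(B ∩ Aᵢ)ᵢ` that a filtration of the `K`-algebra `A` induces on a
`D`-subalgebra `B`. -/
def induced (F : AlgFiltration K A) (B : Subalgebra D A) : AlgFiltration D B where
  obj i := ((F.obj i).restrictScalars D).comap B.val.toLinearMap
  mono _ _ hij _ hx := F.mono hij hx
  one_mem := F.one_mem
  mul_mem ha hb := F.mul_mem ha hb
  exhaustive a := F.exhaustive a.1

theorem induced_below (F : AlgFiltration K A) (B : Subalgebra D A) {i : ℕ} {b : B}
    (hb : b ∈ (F.induced B).below i) : (b : A) ∈ F.below i := by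
  cases i with
  | zero =>
    have h0 : b = 0 := by simpa [below] using hb
    simp [h0]
  | succ i => exact hb

/-- The canonical map `(B ∩ Aᵢ) / (B ∩ Aᵢ₋₁) → Aᵢ / Aᵢ₋₁`. -/
def pieceIncl (F : AlgFiltration K A) (B : Subalgebra D A) (i : ℕ) :
    (F.induced B).Piece i →ₗ[D] F.Piece i :=
  Submodule.liftQ _
    { toFun := fun b => F.cls i b.1.1 b.2
      map_add' := fun _ _ => rfl
      map_smul' := fun _ _ => rfl }
    (by
      intro b hb
      exact (Submodule.Quotient.mk_eq_zero _).2 (F.induced_below B hb))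

/-- The canonical `D`-algebra map `gr B → gr A`. -/
def grIncl (F : AlgFiltration K A) (B : Subalgebra D A) : (F.induced B).Gr →ₐ[D] F.Gr :=
  DirectSum.toAlgebra D _ (fun i => DirectSum.lof D ℕ F.Piece i ∘ₗ F.pieceIncl B i) rfl (by
    intro i j p r
    obtain ⟨a, ha, rfl⟩ := (F.induced B).cls_surj p
    obtain ⟨b, hb, rfl⟩ := (F.induced B).cls_surj r
    exact (DirectSum.of_mul_of (A := F.Piece) (F.cls i a.1 ha) (F.cls j b.1 hb)).symm)

end Induced

end AlgFiltration

/-! ### Congenial algebras -/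

/-- `φ : B → A` exhibits the `D`-algebra `B` as an order of the `K`-algebra `A`: it identifies `B`
with a `D`-subalgebra of `A`, `B` is free over `D`, and `K ⊗ B = A` over `D`. -/
structure IsOrder (K : Type*) {D B A : Type*} [CommRing D] [CommRing K] [Ring B] [Ring A]
    [Algebra D K] [Algebra D B] [Algebra K A] [Algebra D A] [IsScalarTower D K A]
    (φ : B →ₐ[D] A) : Prop where
  injective : Function.Injective φ
  free : Module.Free D B
  baseChange : Function.Bijective (φ.toLinearMap.liftBaseChange K : K ⊗[D] B →ₗ[K] A)

/-- Left and right noetherian. -/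
def IsTwoSidedNoetherian (A : Type*) [Ring A] : Prop :=
  IsNoetherianRing A ∧ IsNoetherianRing Aᵐᵒᵖ

/-- The `D`-algebra `B` is strongly noetherian: `C ⊗ B` over `D` is noetherian for every
commutative noetherian `D`-algebra `C`. -/
def IsStronglyNoetherian.{w, u, v} (D : Type u) (B : Type v) [CommRing D] [Ring B] [Algebra D B] :
    Prop :=
  ∀ (C : Type w) [CommRing C] [Algebra D C], IsNoetherianRing C → IsTwoSidedNoetherian (C ⊗[D] B)

/-- An algebra over a field `k` is PI if it satisfies a nonzero polynomial identity, that is, some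
nonzero noncommutative polynomial over `k` vanishes on it. -/
def IsPIAlgebra (k A : Type*) [CommRing k] [Ring A] [Algebra k A] : Prop :=
  ∃ f : FreeAlgebra k ℕ, f ≠ 0 ∧ ∀ v : ℕ → A, FreeAlgebra.lift k v f = 0

/-- The filtered `k`-algebra `(A, F)` is congenial by means of the finitely generated subring `D`
of `k` and the `D`-subalgebra `B` of `A`. -/
structure IsCongenialVia.{w, u, v} {k : Type u} {A : Type v} [Field k] [Ring A] [Algebra k A]
    (F : AlgFiltration k A) (D : Subalgebra ℤ k) (B : Subalgebra D A) : Prop where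
  locallyFinite : F.IsLocallyFinite
  affine : D.FG
  order : IsOrder k B.val
  order_locallyFinite : (F.induced B).IsLocallyFinite
  gr_order : IsOrder k (F.grIncl B)
  gr_stronglyNoetherian : IsStronglyNoetherian.{w} D (F.induced B).Gr
  gr_locallyFinite : ∀ i, Module.Finite D ((F.induced B).Piece i)
  reduction : ∀ P : Ideal D, P.IsMaximal → Finite (D ⧸ P) →
    Algebra.FiniteType (D ⧸ P) ((D ⧸ P) ⊗[D] B) ∧
    IsTwoSidedNoetherian ((D ⧸ P) ⊗[D] B) ∧
    IsPIAlgebra (D ⧸ P) ((D ⧸ P) ⊗[D] B)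

/-- The `k`-algebra `A` is congenial with respect to the filtration `F`. -/
def IsCongenial.{w, u, v} {k : Type u} {A : Type v} [Field k] [Ring A] [Algebra k A]
    (F : AlgFiltration k A) : Prop :=
  ∃ (D : Subalgebra ℤ k) (B : Subalgebra D A), IsCongenialVia.{w} F D B

/-! ### Filtrations from degrees of generators -/

/-- The filtration obtained by giving degrees `d` to generators `g` of `A`: its `m`-th term is
spanned by the products of generators of total degree at most `m`. -/
def AlgFiltration.ofDegrees {R A ι : Type*} [CommRing R] [Ring A] [Algebra R A]
    (g : ι → A) (d : ι → ℕ) (hg : Algebra.adjoin R (Set.range g) = ⊤) : AlgFiltration R A where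
  obj m := Submodule.span R
    {a | ∃ w : List ι, (w.map d).sum ≤ m ∧ (w.map g).prod = a}
  mono := by
    intro m m' h
    refine Submodule.span_mono ?_
    rintro _ ⟨w, hw, rfl⟩
    exact ⟨w, hw.trans h, rfl⟩
  one_mem := Submodule.subset_span ⟨[], by simp, by simp⟩
  mul_mem := by
    intro i j a b ha hb
    have h := Submodule.mul_mem_mul ha hb
    rw [Submodule.span_mul_span] at h
    refine Submodule.span_mono ?_ h
    rintro _ ⟨_, ⟨w, hw, rfl⟩, _, ⟨w', hw', rfl⟩, rfl⟩
    exact ⟨w ++ w', by simpa using Nat.add_le_add hw hw', by simp⟩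
  exhaustive := by
    intro a
    have ha : a ∈ Submodule.span R (Submonoid.closure (Set.range g) : Set A) := by
      rw [← Algebra.adjoin_eq_span, hg]
      trivial
    have key : ∀ x ∈ (Submonoid.closure (Set.range g) : Set A),
        ∃ w : List ι, (w.map g).prod = x := by
      intro x hx
      induction hx using Submonoid.closure_induction with
      | mem x hx =>
        obtain ⟨i, rfl⟩ := hx
        exact ⟨[i], by simp⟩
      | one => exact ⟨[], rfl⟩
      | mul x y _ _ hx hy =>
        obtain ⟨w, rfl⟩ := hx
        obtain ⟨w', rfl⟩ := hy
        exact ⟨w ++ w', by simp⟩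
    induction ha using Submodule.span_induction with
    | mem x hx =>
      obtain ⟨w, rfl⟩ := key x hx
      exact ⟨_, Submodule.subset_span ⟨w, le_rfl, rfl⟩⟩
    | zero => exact ⟨0, zero_mem _⟩
    | add x y _ _ hx hy =>
      obtain ⟨i, hi⟩ := hx
      obtain ⟨j, hj⟩ := hy
      refine ⟨i + j, add_mem (Submodule.span_mono ?_ hi) (Submodule.span_mono ?_ hj)⟩
      · rintro _ ⟨w, hw, rfl⟩
        exact ⟨w, by omega, rfl⟩
      · rintro _ ⟨w, hw, rfl⟩
        exact ⟨w, by omega, rfl⟩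
    | smul r x _ hx =>
      obtain ⟨i, hi⟩ := hx
      exact ⟨i, Submodule.smul_mem _ r hi⟩

theorem AlgFiltration.gen_mem_ofDegrees {R A ι : Type*} [CommRing R] [Ring A] [Algebra R A]
    (g : ι → A) (d : ι → ℕ) (hg : Algebra.adjoin R (Set.range g) = ⊤) (c : ι) :
    g c ∈ (AlgFiltration.ofDegrees g d hg).obj (d c) :=
  Submodule.subset_span ⟨[c], by simp, by simp⟩

/-! ### Quantum affine spaces -/

/-- The multiparameter matrices `p` with `p_cc = 1` and `p_cd p_dc = 1`. -/
def IsMultiplicativelyAntisymmetric {ι T : Type*} [CommRing T] (p : ι → ι → Tˣ) : Prop :=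
  (∀ c, p c c = 1) ∧ ∀ c d, p c d * p d c = 1

/-- The defining relations `z_c z_d = p_cd z_d z_c` of a quantum affine space. -/
inductive QuantumAffineSpace.Rel {ι T : Type*} [CommRing T] (p : ι → ι → Tˣ) :
    FreeAlgebra T ι → FreeAlgebra T ι → Prop
  | comm (c d : ι) : Rel p (FreeAlgebra.ι T c * FreeAlgebra.ι T d)
      ((p c d : T) • (FreeAlgebra.ι T d * FreeAlgebra.ι T c))

/-- The quantum affine space over `T` with parameters `p`. -/
abbrev QuantumAffineSpace {ι T : Type*} [CommRing T] (p : ι → ι → Tˣ) : Type _ :=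
  RingQuot (QuantumAffineSpace.Rel p)

/-- The coordinate functions of a quantum affine space. -/
def QuantumAffineSpace.z {ι T : Type*} [CommRing T] (p : ι → ι → Tˣ) (c : ι) :
    QuantumAffineSpace p :=
  RingQuot.mkAlgHom T (QuantumAffineSpace.Rel p) (FreeAlgebra.ι T c)

/-! ### Quantized Weyl algebras -/

namespace QuantizedWeyl

variable {T : Type*} [CommRing T] {n : ℕ}

/-- The free generator `xᵢ`. -/
def freeX (T : Type*) [CommRing T] {n : ℕ} (i : Fin n) : FreeAlgebra T (Fin n ⊕ Fin n) :=
  FreeAlgebra.ι T (Sum.inl i)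

/-- The free generator `yᵢ`. -/
def freeY (T : Type*) [CommRing T] {n : ℕ} (i : Fin n) : FreeAlgebra T (Fin n ⊕ Fin n) :=
  FreeAlgebra.ι T (Sum.inr i)

/-- The defining relations of the quantized Weyl algebra. -/
inductive Rel (q : Fin n → Fin n → Tˣ) (γ : Fin n → Tˣ) :
    FreeAlgebra T (Fin n ⊕ Fin n) → FreeAlgebra T (Fin n ⊕ Fin n) → Prop
  | yy (i j : Fin n) : Rel q γ (freeY T i * freeY T j) ((q i j : T) • (freeY T j * freeY T i))
  | xx (i j : Fin n) (h : i < j) :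
      Rel q γ (freeX T i * freeX T j) ((γ i * q i j : T) • (freeX T j * freeX T i))
  | xy_lt (i j : Fin n) (h : i < j) :
      Rel q γ (freeX T i * freeY T j) ((q j i : T) • (freeY T j * freeX T i))
  | xy_gt (i j : Fin n) (h : j < i) :
      Rel q γ (freeX T i * freeY T j) ((γ j * q j i : T) • (freeY T j * freeX T i))
  | xy_eq (j : Fin n) :
      Rel q γ (freeX T j * freeY T j)
        (1 + (γ j : T) • (freeY T j * freeX T j) +
          ∑ l ∈ Finset.univ.filter (· < j), ((γ l : T) - 1) • (freeY T l * freeX T l))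

end QuantizedWeyl

/-- The quantized Weyl algebra with parameters `q` and `γ` over `T`. -/
abbrev QuantizedWeyl {T : Type*} [CommRing T] {n : ℕ} (q : Fin n → Fin n → Tˣ) (γ : Fin n → Tˣ) :
    Type _ :=
  RingQuot (QuantizedWeyl.Rel q γ)

namespace QuantizedWeyl

variable {T : Type*} [CommRing T] {n : ℕ} (q : Fin n → Fin n → Tˣ) (γ : Fin n → Tˣ)

/-- The generators of the quantized Weyl algebra: `gen (inl i)` is `xᵢ` and `gen (inr i)` is
`yᵢ`. -/
def gen (c : Fin n ⊕ Fin n) : QuantizedWeyl q γ :=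
  RingQuot.mkAlgHom T (Rel q γ) (FreeAlgebra.ι T c)

/-- `deg xᵢ = deg yᵢ = i`, where `i` runs through `1, …, n` (so the index `i : Fin n`, which starts
from `0`, is shifted). -/
def deg (c : Fin n ⊕ Fin n) : ℕ := Sum.elim (fun i : Fin n => (i : ℕ) + 1) (fun i : Fin n => (i : ℕ) + 1) c

theorem adjoin_gen : Algebra.adjoin T (Set.range (gen q γ)) = ⊤ := by
  have h : Set.range (gen q γ) =
      (RingQuot.mkAlgHom T (Rel q γ)) '' Set.range (FreeAlgebra.ι T) := by
    rw [← Set.range_comp]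
    rfl
  rw [h, ← AlgHom.map_adjoin, FreeAlgebra.adjoin_range_ι, Algebra.map_top,
    AlgHom.range_eq_top]
  exact RingQuot.mkAlgHom_surjective T _

/-- The standard filtration of the quantized Weyl algebra, with `deg xᵢ = deg yᵢ = i`. -/
def filtration : AlgFiltration T (QuantizedWeyl q γ) :=
  AlgFiltration.ofDegrees (gen q γ) deg (adjoin_gen q γ)

theorem gen_mem (c : Fin n ⊕ Fin n) : gen q γ c ∈ (filtration q γ).obj (deg c) :=
  AlgFiltration.gen_mem_ofDegrees _ _ _ c

section Order

variable {k : Type*} [Field k] {n : ℕ} (q : Fin n → Fin n → kˣ) (γ : Fin n → kˣ)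

/-- The subring of `k` generated by the `q_ij`, the `γ_i` and the `γ_i⁻¹`. -/
def coeffRing : Subalgebra ℤ k :=
  Algebra.adjoin ℤ ((Set.range fun ij : Fin n × Fin n => (q ij.1 ij.2 : k)) ∪
    (Set.range fun i => (γ i : k)) ∪ Set.range fun i => ((γ i)⁻¹ : k))

/-- The subalgebra, over the coefficient ring, generated by the `xᵢ` and `yᵢ`. -/
def integralForm : Subalgebra (coeffRing q γ) (QuantizedWeyl q γ) :=
  Algebra.adjoin (coeffRing q γ) (Set.range (gen q γ))

/-- The generators as elements of the integral form. -/
def integralGen (c : Fin n ⊕ Fin n) : integralForm q γ :=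
  ⟨gen q γ c, Algebra.subset_adjoin ⟨c, rfl⟩⟩

theorem integralGen_mem (c : Fin n ⊕ Fin n) :
    integralGen q γ c ∈ ((filtration q γ).induced (integralForm q γ)).obj (deg c) :=
  gen_mem q γ c

end Order

end QuantizedWeyl

end

universe w

/-!
Modulo terms of lower degree, the generators of a quantized Weyl algebra commute up to units.
Sorting words by induction on their degree, ordered monomials span each term of the filtration.

They are also linearly independent, over every commutative ring `T`. In the Fock representation on
polynomials in `t_1, …, t_n`, up to rescalings `y_i` multiplies by `t_i` and `x_i` is a
`γ_i`-derivative in `t_i`, so that ordered monomials act by a triangular matrix with geometric sums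
`1 + γ_i + ⋯ + γ_i ^ m` on its diagonal. These may be zero divisors in `T`, but after replacing
every `γ_i` by `γ_i X` over `T[X, X⁻¹]` they are not, and bases survive the specialization `X = 1`.

Hence ordered monomials form bases of the algebra and of its integral form, adapted to the
filtrations. The symbols of the generators commute exactly up to units and their ordered monomials
form a basis of the associated graded ring, which is therefore a quantum affine space. Sending a
left ideal to the ideal of a polynomial ring generated by its leading terms is strictly monotone,
so quantum affine spaces over noetherian rings are noetherian.

Over a finite ring there is an `N > 0` with `u ^ N = 1` and `1 + u + ⋯ + u ^ (N - 1) = 0` for every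
unit `u`. These identities make the `N`-th powers of the generators central, so the reduction is a
finite module over a noetherian commutative ring. As such it is noetherian, and an alternating
multilinear function of more arguments than there are module generators vanishes on it, in
particular a standard polynomial.
-/

/-! ### Ordered monomials in skew-commuting elements -/

section OrderedMonomial

variable {ι S : Type*} [Monoid S]

/-- The word in which the letters of `L` occur in the order of `L`, with multiplicities `a`. -/
def orderedWord (L : List ι) (a : ι →₀ ℕ) : List ι :=
  L.flatMap fun c => List.replicate (a c) c

/-- The monomial with exponents `a` in the elements `g c`, multiplied in the order of `L`. -/
def orderedMonomial (L : List ι) (g : ι → S) (a : ι →₀ ℕ) : S :=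
  (L.map fun c => g c ^ a c).prod

theorem prod_map_orderedWord (L : List ι) (g : ι → S) (a : ι →₀ ℕ) :
    ((orderedWord L a).map g).prod = orderedMonomial L g a := by
  induction L with
  | nil => rfl
  | cons c L ih => simpa [orderedWord, orderedMonomial] using congrArg (g c ^ a c * ·) ih

theorem map_orderedMonomial {S' F : Type*} [Monoid S'] [FunLike F S S'] [MonoidHomClass F S S']
    (φ : F) (L : List ι) (g : ι → S) (a : ι →₀ ℕ) :
    φ (orderedMonomial L g a) = orderedMonomial L (fun c => φ (g c)) a := by
  simp [orderedMonomial, map_list_prod, Function.comp_def]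

theorem coe_orderedWord {L : List ι} (hL : L.Nodup) (hmem : ∀ c, c ∈ L) (a : ι →₀ ℕ) :
    (orderedWord L a : Multiset ι) = Finsupp.toMultiset a := by
  classical
  have count_eq : ∀ (L : List ι) (c : ι), (orderedWord L a).count c = L.count c * a c := by
    intro L c
    induction L with
    | nil => simp [orderedWord]
    | cons b L ih =>
      simp only [orderedWord, List.flatMap_cons, List.count_append, List.count_replicate,
        List.count_cons] at ih ⊢
      obtain rfl | hbc := eq_or_ne b c
      · simp [ih, add_mul, add_comm]
      · simp [ih, hbc]
  ext c
  rw [Multiset.coe_count, count_eq, List.count_eq_one_of_mem hL (hmem c), one_mul,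
    Finsupp.count_toMultiset]

theorem perm_orderedWord {L : List ι} (hL : L.Nodup) (hmem : ∀ c, c ∈ L) {a : ι →₀ ℕ}
    {w : List ι} (h : (w : Multiset ι) = Finsupp.toMultiset a) : w.Perm (orderedWord L a) :=
  Multiset.coe_eq_coe.1 (h.trans (coe_orderedWord hL hmem a).symm)

theorem sum_map_eq_weight (d : ι → ℕ) {a : ι →₀ ℕ} {w : List ι}
    (h : (w : Multiset ι) = Finsupp.toMultiset a) : (w.map d).sum = Finsupp.weight d a := by
  rw [← Multiset.sum_coe, ← Multiset.map_coe, h, Finsupp.toMultiset_apply, Finsupp.weight_apply,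
    Finsupp.sum, Finsupp.sum, ← Multiset.coe_mapAddMonoidHom, map_sum, Multiset.sum_sum]
  simp [Multiset.map_nsmul, Multiset.sum_nsmul]

end OrderedMonomial

namespace AlgFiltration

variable {ι T S : Type*} [CommRing T] [Ring S] [Algebra T S]

/-- The filtration of an algebra that consists of the whole algebra in every degree. -/
def trivial (T S : Type*) [CommRing T] [Ring S] [Algebra T S] : AlgFiltration T S where
  obj _ := ⊤
  mono _ _ _ := le_rfl
  one_mem := Submodule.mem_top
  mul_mem _ _ := Submodule.mem_top
  exhaustive _ := ⟨0, Submodule.mem_top⟩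

theorem obj_le_below (F : AlgFiltration T S) {i j : ℕ} (h : i < j) : F.obj i ≤ F.below j := by
  cases j with
  | zero => omega
  | succ j => exact F.mono (Nat.le_of_lt_succ h)

theorem below_le_obj (F : AlgFiltration T S) (i : ℕ) : F.below i ≤ F.obj i := by
  cases i with
  | zero => exact bot_le
  | succ i => exact F.mono i.le_succ

/-- The elements `g c` have filtration degrees `d c`, and they commute up to the units `p` and up
to terms of lower degree. -/
structure SkewCommute (F : AlgFiltration T S) (p : ι → ι → Tˣ) (g : ι → S) (d : ι → ℕ) :
    Prop where
  mem_obj (c : ι) : g c ∈ F.obj (d c)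
  sub_mem_below (c c' : ι) : g c * g c' - (p c c' : T) • (g c' * g c) ∈ F.below (d c + d c')

namespace SkewCommute

variable {F : AlgFiltration T S} {p : ι → ι → Tˣ} {g : ι → S} {d : ι → ℕ}

theorem prod_map_mem (h : F.SkewCommute p g d) (w : List ι) :
    (w.map g).prod ∈ F.obj (w.map d).sum := by
  induction w with
  | nil => exact F.one_mem
  | cons c w ih => simpa using F.mul_mem (h.mem_obj c) ih

theorem exists_prod_sub_smul_mem_below (h : F.SkewCommute p g d) {w w' : List ι}
    (hw : w.Perm w') :
    ∃ u : Tˣ, (w.map g).prod - (u : T) • (w'.map g).prod ∈ F.below (w.map d).sum := by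
  induction hw with
  | nil => exact ⟨1, by simp⟩
  | cons c _ ih =>
    obtain ⟨u, hu⟩ := ih
    exact ⟨u, by simpa [mul_sub] using F.mul_mem_below_right (h.mem_obj c) hu⟩
  | swap c c' l =>
    refine ⟨p c' c, ?_⟩
    simpa [sub_mul, mul_assoc, add_assoc] using
      F.mul_mem_below_left (h.sub_mem_below c' c) (h.prod_map_mem l)
  | trans hw _ ih ih' =>
    obtain ⟨u, hu⟩ := ih
    obtain ⟨v, hv⟩ := ih'
    rw [← (hw.map d).sum_eq] at hv
    refine ⟨u * v, ?_⟩
    simpa [smul_sub, smul_smul] using add_mem hu (Submodule.smul_mem _ (u : T) hv)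

theorem exists_prod_sub_smul_orderedMonomial_mem_below (h : F.SkewCommute p g d) {L : List ι}
    (hL : L.Nodup) (hmem : ∀ c, c ∈ L) {w : List ι} {a : ι →₀ ℕ}
    (hw : (w : Multiset ι) = Finsupp.toMultiset a) :
    ∃ u : Tˣ, (w.map g).prod - (u : T) • orderedMonomial L g a ∈
      F.below (Finsupp.weight d a) := by
  rw [← prod_map_orderedWord, ← sum_map_eq_weight d hw]
  exact h.exists_prod_sub_smul_mem_below (perm_orderedWord hL hmem hw)

end SkewCommute

/-- Ordered monomials of bounded weight span the filtration given by the degrees of generators: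
reordering a word only creates words of smaller degree, so one inducts on the degree. -/
theorem ofDegrees_obj_eq_span {p : ι → ι → Tˣ} {g : ι → S} {d : ι → ℕ}
    (hg : Algebra.adjoin T (Set.range g) = ⊤) (h : (ofDegrees g d hg).SkewCommute p g d)
    {L : List ι} (hL : L.Nodup) (hmem : ∀ c, c ∈ L) (m : ℕ) :
    (ofDegrees g d hg).obj m =
      Submodule.span T (orderedMonomial L g '' {a | Finsupp.weight d a ≤ m}) := by
  classical
  refine le_antisymm ?_ (Submodule.span_le.2 ?_)
  · induction m using Nat.strong_induction_on with
    | _ m ih =>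
    have below_le : ∀ j ≤ m, (ofDegrees g d hg).below j ≤
        Submodule.span T (orderedMonomial L g '' {a | Finsupp.weight d a ≤ m}) := by
      rintro (_ | j) hj
      · exact bot_le
      · exact (ih j hj).trans (Submodule.span_mono
          (Set.image_mono fun a ha => le_trans ha (Nat.le_of_succ_le hj)))
    refine Submodule.span_le.2 ?_
    rintro _ ⟨w, hw, rfl⟩
    set a := Multiset.toFinsupp (w : Multiset ι) with ha
    have hwa : (w : Multiset ι) = Finsupp.toMultiset a := by simp [ha]
    rw [sum_map_eq_weight d hwa] at hw
    obtain ⟨u, hu⟩ := h.exists_prod_sub_smul_orderedMonomial_mem_below hL hmem hwa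
    simpa using add_mem (below_le _ hw hu)
      (Submodule.smul_mem _ (u : T) (Submodule.subset_span ⟨a, hw, rfl⟩))
  · rintro _ ⟨a, ha, rfl⟩
    refine Submodule.subset_span ⟨orderedWord L a, ?_, prod_map_orderedWord L g a⟩
    rwa [sum_map_eq_weight d (coe_orderedWord hL hmem a)]

end AlgFiltration

section SkewCommute

variable {ι T S : Type*} [CommRing T] [Ring S] [Algebra T S] {p : ι → ι → Tˣ} {g : ι → S}

/-- The elements `g c` commute up to the units `p`. -/
def SkewCommute (p : ι → ι → Tˣ) (g : ι → S) : Prop :=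
  ∀ c c', g c * g c' = (p c c' : T) • (g c' * g c)

namespace SkewCommute

theorem filtered (h : SkewCommute p g) (F : AlgFiltration T S)
    (hF : ∀ c, g c ∈ F.obj 0) : F.SkewCommute p g 0 where
  mem_obj := hF
  sub_mem_below c c' := by simp [h c c']

theorem map {S' : Type*} [Ring S'] [Algebra T S'] (h : SkewCommute p g) (φ : S →ₐ[T] S') :
    SkewCommute p fun c => φ (g c) := fun c c' => by
  rw [← map_mul, h c c', map_smul, map_mul]

theorem exists_orderedMonomial_mul (h : SkewCommute p g) {L : List ι} (hL : L.Nodup)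
    (hmem : ∀ c, c ∈ L) (a b : ι →₀ ℕ) :
    ∃ u : Tˣ, orderedMonomial L g a * orderedMonomial L g b =
      (u : T) • orderedMonomial L g (a + b) := by
  have hw : ((orderedWord L a ++ orderedWord L b : List ι) : Multiset ι) =
      Finsupp.toMultiset (a + b) := by
    rw [← Multiset.coe_add, coe_orderedWord hL hmem, coe_orderedWord hL hmem, map_add]
  obtain ⟨u, hu⟩ := (h.filtered (.trivial T S) fun _ => Submodule.mem_top)
    |>.exists_prod_sub_smul_orderedMonomial_mem_below hL hmem hw
  have weight_zero : Finsupp.weight (0 : ι → ℕ) (a + b) = 0 := by simp [Finsupp.weight_apply]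
  rw [weight_zero, List.map_append, List.prod_append, prod_map_orderedWord,
    prod_map_orderedWord] at hu
  exact ⟨u, sub_eq_zero.1 ((Submodule.mem_bot T).1 hu)⟩

theorem span_orderedMonomial_eq_top (h : SkewCommute p g)
    (hg : Algebra.adjoin T (Set.range g) = ⊤) {L : List ι} (hL : L.Nodup)
    (hmem : ∀ c, c ∈ L) : Submodule.span T (Set.range (orderedMonomial L g)) = ⊤ := by
  refine eq_top_iff.2 fun s _ => ?_
  obtain ⟨m, hm⟩ := (AlgFiltration.ofDegrees g 0 hg).exhaustive s
  rw [AlgFiltration.ofDegrees_obj_eq_span hg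
    (h.filtered _ (AlgFiltration.gen_mem_ofDegrees g 0 hg)) hL hmem] at hm
  exact Submodule.span_mono (Set.image_subset_range _ _) hm

end SkewCommute

end SkewCommute

/-! ### Adapted bases of filtered algebras -/

theorem dfinsuppBasis_apply {κ R : Type*} {η : κ → Type*} {M : κ → Type*} [Semiring R]
    [∀ i, AddCommMonoid (M i)] [∀ i, Module R (M i)] [DecidableEq κ]
    (b : ∀ i, Module.Basis (η i) R (M i)) (x : Σ i, η i) :
    DFinsupp.basis b x = DFinsupp.single x.1 (b x.1 x.2) := by
  rw [← (DFinsupp.basis b).repr_symm_single_one]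
  change DFinsupp.mapRange (fun i => (b i).repr.symm) (fun _ => map_zero _)
    (sigmaFinsuppEquivDFinsupp (Finsupp.single x 1)) = _
  rw [sigmaFinsuppEquivDFinsupp_single, DFinsupp.mapRange_single, Module.Basis.repr_symm_single_one]

namespace AlgFiltration

section Symbol

variable {T S : Type*} [CommRing T] [Ring S] [Algebra T S] (F : AlgFiltration T S)

theorem finite_piece (hF : F.IsLocallyFinite) (i : ℕ) : Module.Finite T (F.Piece i) :=
  have := hF i
  Module.Finite.of_surjective ((F.below i).submoduleOf (F.obj i)).mkQ
    (Submodule.mkQ_surjective _)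

theorem cls_linearCombination {J : Type*} {i : ℕ} (v : J → F.obj i) (l : J →₀ T)
    (hl : Finsupp.linearCombination T (fun j => (v j : S)) l ∈ F.obj i) :
    F.cls i (Finsupp.linearCombination T (fun j => (v j : S)) l) hl =
      Finsupp.linearCombination T (fun j => F.cls i (v j) (v j).2) l := by
  have hv := (Finsupp.apply_linearCombination T (F.obj i).subtype v l).symm
  calc _ = ((F.below i).submoduleOf (F.obj i)).mkQ (Finsupp.linearCombination T v l) :=
        F.cls_congr hl (Finsupp.linearCombination T v l).2 hv
    _ = _ := Finsupp.apply_linearCombination T ((F.below i).submoduleOf (F.obj i)).mkQ v l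

theorem symbol_congr {i j : ℕ} {s t : S} (hs : s ∈ F.obj i) (ht : t ∈ F.obj j)
    (hij : i = j) (hst : s = t) : F.symbol i s hs = F.symbol j t ht := by
  subst hij hst
  rfl

theorem symbol_eq_symbol {i : ℕ} {s t : S} {hs : s ∈ F.obj i} {ht : t ∈ F.obj i}
    (h : s - t ∈ F.below i) : F.symbol i s hs = F.symbol i t ht :=
  congrArg _ (F.cls_eq_cls.2 h)

theorem symbol_smul {i : ℕ} (r : T) {s : S} (hs : s ∈ F.obj i) :
    F.symbol i (r • s) ((F.obj i).smul_mem r hs) = r • F.symbol i s hs :=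
  (DirectSum.lof T ℕ F.Piece i).map_smul r (F.cls i s hs)

theorem symbol_mul {i j : ℕ} {s t : S} (hs : s ∈ F.obj i) (ht : t ∈ F.obj j) :
    F.symbol i s hs * F.symbol j t ht = F.symbol (i + j) (s * t) (F.mul_mem hs ht) :=
  DirectSum.of_mul_of (A := F.Piece) (F.cls i s hs) (F.cls j t ht)

theorem grIncl_symbol {D K A : Type*} [CommRing D] [CommRing K] [Ring A] [Algebra D K]
    [Algebra K A] [Algebra D A] [IsScalarTower D K A] (F : AlgFiltration K A)
    (B : Subalgebra D A) {i : ℕ} {s : B} (hs : s ∈ (F.induced B).obj i) :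
    F.grIncl B ((F.induced B).symbol i s hs) = F.symbol i (s : A) hs :=
  DirectSum.toModule_lof D i _

end Symbol

namespace SkewCommute

variable {ι T S : Type*} [CommRing T] [Ring S] [Algebra T S] {F : AlgFiltration T S}
  {p : ι → ι → Tˣ} {g : ι → S} {d : ι → ℕ}

theorem symbol (h : F.SkewCommute p g d) :
    _root_.SkewCommute p fun c => F.symbol (d c) (g c) (h.mem_obj c) := fun c c' => by
  have hmul : g c' * g c ∈ F.obj (d c + d c') :=
    add_comm (d c') (d c) ▸ F.mul_mem (h.mem_obj c') (h.mem_obj c)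
  rw [symbol_mul, symbol_mul, F.symbol_congr _ hmul (add_comm _ _) rfl, ← symbol_smul]
  exact F.symbol_eq_symbol (h.sub_mem_below c c')

theorem prod_map_symbol (h : F.SkewCommute p g d) (w : List ι) :
    (w.map fun c => F.symbol (d c) (g c) (h.mem_obj c)).prod =
      F.symbol (w.map d).sum (w.map g).prod (h.prod_map_mem w) := by
  induction w with
  | nil => rfl
  | cons c w ih =>
    rw [List.map_cons, List.prod_cons, ih, symbol_mul]
    exact F.symbol_congr _ _ (by simp) (by simp)

theorem orderedMonomial_symbol (h : F.SkewCommute p g d) {L : List ι} (hL : L.Nodup)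
    (hmem : ∀ c, c ∈ L) {a : ι →₀ ℕ}
    (ha : orderedMonomial L g a ∈ F.obj (Finsupp.weight d a)) :
    orderedMonomial L (fun c => F.symbol (d c) (g c) (h.mem_obj c)) a =
      F.symbol (Finsupp.weight d a) (orderedMonomial L g a) ha := by
  rw [← prod_map_orderedWord, h.prod_map_symbol]
  exact F.symbol_congr _ _ (sum_map_eq_weight d (coe_orderedWord hL hmem a))
    (prod_map_orderedWord L g a)

end SkewCommute

/-- A basis `b` whose elements carry degrees `δ` is adapted to a filtration if every term of the
filtration is spanned by the basis elements of bounded degree. -/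
def IsAdapted {T S I : Type*} [CommRing T] [Ring S] [Algebra T S] (F : AlgFiltration T S)
    (b : Module.Basis I T S) (δ : I → ℕ) : Prop :=
  ∀ m, F.obj m = Submodule.span T (b '' {a | δ a ≤ m})

namespace IsAdapted

section GradedBasis

variable {T S I : Type*} [CommRing T] [Ring S] [Algebra T S] {F : AlgFiltration T S}
  {b : Module.Basis I T S} {δ : I → ℕ}

theorem mem_obj (h : F.IsAdapted b δ) (a : I) : b a ∈ F.obj (δ a) := by
  rw [h]
  exact Submodule.subset_span ⟨a, le_refl (δ a), rfl⟩

theorem mem_obj_of_eq (h : F.IsAdapted b δ) {i : ℕ} (a : {a // δ a = i}) : b a ∈ F.obj i := by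
  have hm := h.mem_obj a
  rwa [a.2] at hm

theorem below_eq_span (h : F.IsAdapted b δ) (m : ℕ) :
    F.below m = Submodule.span T (b '' {a | δ a < m}) := by
  cases m with
  | zero => simp [below]
  | succ m => simp only [below, h m, Nat.lt_succ_iff]

theorem isLocallyFinite (h : F.IsAdapted b δ) (hδ : ∀ m, {a | δ a ≤ m}.Finite) :
    F.IsLocallyFinite := fun m => by
  rw [h m]
  exact .span_of_finite T ((hδ m).image b)

theorem linearIndependent_cls (h : F.IsAdapted b δ) (i : ℕ) :
    LinearIndependent T fun a : {a // δ a = i} =>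
      F.cls i (b a) (h.mem_obj_of_eq a) := by
  have disjoint : Disjoint (Submodule.span T (b '' {a | δ a = i})) (F.below i) := by
    rw [h.below_eq_span]
    exact b.linearIndependent.disjoint_span_image
      (Set.disjoint_left.2 fun a (ha : _ = _) (ha' : _ < _) => ha'.ne ha)
  refine linearIndependent_iff.2 fun l hl => ?_
  have hmem : Finsupp.linearCombination T (fun a : {a // δ a = i} => b a) l ∈
      Submodule.span T (b '' {a | δ a = i}) :=
    Submodule.finsuppSum_mem _ _ l _ fun a _ =>
      Submodule.smul_mem _ _ (Submodule.subset_span ⟨a, a.2, rfl⟩)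
  have hobj := h i ▸ Submodule.span_mono (Set.image_mono fun a => le_of_eq) hmem
  rw [← F.cls_linearCombination (fun a : {a // δ a = i} => ⟨b a, h.mem_obj_of_eq a⟩) l hobj,
    ← F.cls_zero, F.cls_eq_cls, sub_zero] at hl
  exact linearIndependent_iff.1 (b.linearIndependent.comp _ Subtype.val_injective) l
    (Submodule.disjoint_def.1 disjoint _ hmem hl)

theorem span_cls_eq_top (h : F.IsAdapted b δ) (i : ℕ) :
    Submodule.span T (Set.range fun a : {a // δ a = i} =>
      F.cls i (b a) (h.mem_obj_of_eq a)) = ⊤ := by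
  refine eq_top_iff.2 fun x _ => ?_
  obtain ⟨s, hs, rfl⟩ := F.cls_surj x
  have obj_eq_sup : F.obj i = Submodule.span T (Set.range fun a : {a // δ a = i} => b a) ⊔
      F.below i := by
    rw [h i, h.below_eq_span, Set.image_eq_range b {a | δ a < i}, ← Submodule.span_union]
    congr 1
    ext x
    simp [le_iff_eq_or_lt, or_and_right, exists_or]
  obtain ⟨t, ht, u, hu, rfl⟩ := Submodule.mem_sup.1 (obj_eq_sup ▸ hs)
  obtain ⟨l, rfl⟩ := Finsupp.mem_span_range_iff_exists_finsupp.1 ht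
  have hl := (F.obj i).sub_mem hs (F.below_le_obj i hu)
  rw [add_sub_cancel_right] at hl
  rw [F.cls_eq_cls (hb := hl).2 (by simpa using hu)]
  exact Finsupp.mem_span_range_iff_exists_finsupp.2 ⟨l,
    (F.cls_linearCombination (fun a : {a // δ a = i} => ⟨b a, h.mem_obj_of_eq a⟩) l hl).symm⟩

/-- The classes of the elements of an adapted basis, as a basis of the associated graded ring. -/
noncomputable def gradedBasis (h : F.IsAdapted b δ) : Module.Basis I T F.Gr :=
  Module.Basis.reindex
    (DFinsupp.basis fun i => Module.Basis.mk (h.linearIndependent_cls i) (h.span_cls_eq_top i).ge)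
    (Equiv.sigmaFiberEquiv δ)

theorem gradedBasis_apply (h : F.IsAdapted b δ) (a : I) :
    h.gradedBasis a = F.symbol (δ a) (b a) (h.mem_obj a) := by
  rw [gradedBasis, Module.Basis.reindex_apply, dfinsuppBasis_apply, Module.Basis.mk_apply]
  rfl

end GradedBasis

end IsAdapted

end AlgFiltration

/-! ### Orders and quantum affine spaces -/

section Order

variable {D K A B I : Type*} [CommRing D] [CommRing K] [Ring A] [Ring B] [Algebra D K]
  [Algebra K A] [Algebra D A] [IsScalarTower D K A] [Algebra D B]

theorem repr_map_eq_algebraMap_repr (b : Module.Basis I D B) (b' : Module.Basis I K A)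
    (φ : B →ₐ[D] A) (hφ : ∀ a, φ (b a) = b' a) (s : B) (a : I) :
    b'.repr (φ s) a = algebraMap D K (b.repr s a) := by
  classical
  have coord_comp : (b'.coord a).restrictScalars D ∘ₗ φ.toLinearMap =
      Algebra.linearMap D K ∘ₗ b.coord a :=
    b.ext fun c => by simp [hφ, Finsupp.single_apply, apply_ite (algebraMap D K)]
  exact LinearMap.congr_fun coord_comp s

theorem IsOrder.of_basis (hDK : Function.Injective (algebraMap D K)) (b : Module.Basis I D B)
    (b' : Module.Basis I K A) (φ : B →ₐ[D] A) (hφ : ∀ a, φ (b a) = b' a) : IsOrder K φ where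
  injective := by
    refine (injective_iff_map_eq_zero φ).2 fun s hs => b.ext_elem fun a => hDK ?_
    rw [← repr_map_eq_algebraMap_repr b b' φ hφ, hs]
    simp
  free := .of_basis b
  baseChange := by
    have eq_equiv : φ.toLinearMap.liftBaseChange K =
        (b.baseChange K).equiv b' (Equiv.refl I) := by
      refine (b.baseChange K).ext fun a => ?_
      rw [LinearEquiv.coe_coe, Module.Basis.equiv_apply]
      simp [hφ]
    rw [← LinearMap.coe_coe, eq_equiv]
    exact LinearEquiv.bijective _

namespace AlgFiltration.IsAdapted

variable {F : AlgFiltration K A} {C : Subalgebra D A} {b : Module.Basis I D C}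
  {b' : Module.Basis I K A} {δ : I → ℕ}

theorem induced (h : F.IsAdapted b' δ) (hDK : Function.Injective (algebraMap D K))
    (hb : ∀ a, (b a : A) = b' a) : (F.induced C).IsAdapted b δ := by
  intro m
  ext s
  have support_eq : (b'.repr (s : A)).support = (b.repr s).support := by
    ext a
    have repr_eq : b'.repr (s : A) a = _ := repr_map_eq_algebraMap_repr b b' C.val hb s a
    simp [repr_eq, map_eq_zero_iff _ hDK]
  change (s : A) ∈ F.obj m ↔ _
  rw [h m, b'.mem_span_image, b.mem_span_image, support_eq]

theorem isOrder_grIncl (h : F.IsAdapted b' δ) (hDK : Function.Injective (algebraMap D K))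
    (hb : ∀ a, (b a : A) = b' a) : IsOrder K (F.grIncl C) :=
  .of_basis hDK (h.induced hDK hb).gradedBasis h.gradedBasis _ fun a => by
    rw [gradedBasis_apply, gradedBasis_apply, grIncl_symbol]
    exact F.symbol_congr _ _ rfl (hb a)

end AlgFiltration.IsAdapted

end Order

namespace QuantumAffineSpace

variable {ι T S : Type*} [CommRing T] [Ring S] [Algebra T S] {p : ι → ι → Tˣ} {g : ι → S}

theorem skewCommute_z (p : ι → ι → Tˣ) : SkewCommute p (z p) := fun c c' => by
  simpa [z] using RingQuot.mkAlgHom_rel T (Rel.comm (p := p) c c')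

theorem adjoin_z (p : ι → ι → Tˣ) : Algebra.adjoin T (Set.range (z p)) = ⊤ := by
  have range_z : Set.range (z p) =
      RingQuot.mkAlgHom T (Rel p) '' Set.range (FreeAlgebra.ι T) := by
    rw [← Set.range_comp]
    rfl
  rw [range_z, ← AlgHom.map_adjoin, FreeAlgebra.adjoin_range_ι, Algebra.map_top,
    AlgHom.range_eq_top]
  exact RingQuot.mkAlgHom_surjective T _

/-- The algebra map out of a quantum affine space given by elements that satisfy its relations. -/
noncomputable def lift (hg : SkewCommute p g) : QuantumAffineSpace p →ₐ[T] S :=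
  RingQuot.liftAlgHom T ⟨FreeAlgebra.lift T g, by
    rintro _ _ ⟨c, c'⟩
    simpa using hg c c'⟩

@[simp]
theorem lift_z (hg : SkewCommute p g) (c : ι) : lift hg (z p c) = g c := by
  simp [lift, z]

theorem lift_bijective (hg : SkewCommute p g) {L : List ι} (hL : L.Nodup) (hmem : ∀ c, c ∈ L)
    (b : Module.Basis (ι →₀ ℕ) T S) (hb : ∀ a, b a = orderedMonomial L g a) :
    Function.Bijective (lift hg) := by
  have lift_monomial (a : ι →₀ ℕ) : lift hg (orderedMonomial L (z p) a) = b a := by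
    simp only [map_orderedMonomial, lift_z, hb]
  have linearIndependent_z : LinearIndependent T (orderedMonomial L (z p)) :=
    .of_comp (lift hg).toLinearMap (by
      convert b.linearIndependent
      exact funext lift_monomial)
  let bz := Module.Basis.mk linearIndependent_z
    ((skewCommute_z p).span_orderedMonomial_eq_top (adjoin_z p) hL hmem).ge
  have eq_equiv : (lift hg).toLinearMap = bz.equiv b (Equiv.refl _) := by
    refine bz.ext fun a => ?_
    rw [LinearEquiv.coe_coe, Module.Basis.equiv_apply]
    simp [bz, lift_monomial]
  rw [← AlgHom.coe_toLinearMap, eq_equiv]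
  exact LinearEquiv.bijective _

end QuantumAffineSpace

theorem AlgFiltration.IsAdapted.exists_quantumAffineSpace_equiv {ι T S : Type*} [CommRing T]
    [Ring S] [Algebra T S] {F : AlgFiltration T S} {p : ι → ι → Tˣ} {g : ι → S} {d : ι → ℕ}
    (hg : F.SkewCommute p g d) {L : List ι} (hL : L.Nodup) (hmem : ∀ c, c ∈ L)
    {b : Module.Basis (ι →₀ ℕ) T S} (h : F.IsAdapted b (Finsupp.weight d))
    (hb : ∀ a, b a = orderedMonomial L g a) :
    ∃ e : QuantumAffineSpace p ≃ₐ[T] F.Gr,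
      ∀ c, e (QuantumAffineSpace.z p c) = F.symbol (d c) (g c) (hg.mem_obj c) := by
  have gradedBasis_eq (a : ι →₀ ℕ) : h.gradedBasis a =
      orderedMonomial L (fun c => F.symbol (d c) (g c) (hg.mem_obj c)) a := by
    rw [hg.orderedMonomial_symbol hL hmem (hb a ▸ h.mem_obj a), h.gradedBasis_apply]
    exact F.symbol_congr _ _ rfl (hb a)
  exact ⟨.ofBijective _ (QuantumAffineSpace.lift_bijective hg.symbol hL hmem _ gradedBasis_eq),
    QuantumAffineSpace.lift_z hg.symbol⟩

theorem AlgFiltration.SkewCommute.of_induced {ι D K A : Type*} [CommRing D] [CommRing K] [Ring A]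
    [Algebra D K] [Algebra K A] [Algebra D A] [IsScalarTower D K A] {F : AlgFiltration K A}
    {B : Subalgebra D A} {p : ι → ι → Dˣ} {g : ι → B} {d : ι → ℕ}
    (h : (F.induced B).SkewCommute p g d) :
    F.SkewCommute (fun c c' => Units.map (algebraMap D K : D →* K) (p c c')) (fun c => (g c : A))
      d where
  mem_obj := h.mem_obj
  sub_mem_below c c' := by simpa using F.induced_below B (h.sub_mem_below c c')

/-! ### Noetherianity by leading coefficients -/

/-- The elements `e a`, indexed by exponents, multiply like monomials up to units of `C`. -/
def IsTwistedMonomial {ι S : Type*} (C : Type*) [CommRing C] [Ring S] [Algebra C S]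
    (e : (ι →₀ ℕ) → S) : Prop :=
  ∀ a b, ∃ u : Cˣ, e a * e b = (u : C) • e (a + b)

namespace IsTwistedMonomial

open scoped MonomialOrder

variable {ι C S : Type*} [CommRing C] [Ring S] [Algebra C S] (m : MonomialOrder ι)
  {e : (ι →₀ ℕ) → S}

/-- The span of the elements `e b` with `b` smaller than `a`. -/
def lower (C : Type*) [CommRing C] [Algebra C S] (e : (ι →₀ ℕ) → S) (a : ι →₀ ℕ) :
    Submodule C S :=
  Submodule.span C (e '' {b | b ≺[m] a})

/-- The ideal of the coefficients of `e a` in the elements of `I` whose leading exponent is at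
most `a`. -/
def leadingIdeal (C : Type*) [CommRing C] [Algebra C S] (e : (ι →₀ ℕ) → S) (I : Ideal S)
    (a : ι →₀ ℕ) : Ideal C :=
  ((I.restrictScalars C) ⊔ lower m C e a).comap (LinearMap.toSpanSingleton C S (e a))

theorem mem_leadingIdeal {I : Ideal S} {a : ι →₀ ℕ} {c : C} :
    c ∈ leadingIdeal m C e I a ↔ ∃ f ∈ I, ∃ l ∈ lower m C e a, f + l = c • e a := by
  simp [leadingIdeal, Submodule.mem_sup]

theorem leadingIdeal_mono {I J : Ideal S} (h : I ≤ J) (a : ι →₀ ℕ) :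
    leadingIdeal m C e I a ≤ leadingIdeal m C e J a :=
  Submodule.comap_mono <| sup_le_sup_right
    (show I.restrictScalars C ≤ J.restrictScalars C from h) _

theorem mul_mem_lower (he : IsTwistedMonomial C e) {a b : ι →₀ ℕ} {l : S}
    (hl : l ∈ lower m C e a) : e b * l ∈ lower m C e (b + a) := by
  suffices h : lower m C e a ≤ (lower m C e (b + a)).comap (LinearMap.mulLeft C (e b)) from h hl
  refine Submodule.span_le.2 ?_
  rintro _ ⟨c, hc, rfl⟩
  obtain ⟨u, hu⟩ := he b c
  have hlt : b + c ≺[m] b + a := by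
    rw [map_add, map_add]
    exact add_lt_add_right hc _
  have hmem : e (b + c) ∈ lower m C e (b + a) := Submodule.subset_span ⟨b + c, hlt, rfl⟩
  simpa [hu] using Submodule.smul_mem _ (u : C) hmem

theorem leadingIdeal_le_add (he : IsTwistedMonomial C e) (I : Ideal S) (a b : ι →₀ ℕ) :
    leadingIdeal m C e I a ≤ leadingIdeal m C e I (b + a) := by
  intro c hc
  obtain ⟨f, hf, l, hl, hfl⟩ := (mem_leadingIdeal m).1 hc
  obtain ⟨u, hu⟩ := he b a
  refine (mem_leadingIdeal m).2 ⟨(↑u⁻¹ : C) • (e b * f),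
    (I.restrictScalars C).smul_mem _ (I.mul_mem_left _ hf), (↑u⁻¹ : C) • (e b * l),
    Submodule.smul_mem _ _ (mul_mem_lower m he hl), ?_⟩
  rw [← smul_add, ← mul_add, hfl, mul_smul_comm, hu, smul_comm, smul_smul (↑u⁻¹ : C),
    Units.inv_mul, one_smul]

/-- The ideal of the polynomial ring generated by the leading terms of the elements of `I`. -/
def initialIdeal (he : IsTwistedMonomial C e) (I : Ideal S) : Ideal (MvPolynomial ι C) where
  carrier := {p | ∀ a, p.coeff a ∈ leadingIdeal m C e I a}
  add_mem' hp hr a := by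
    rw [MvPolynomial.coeff_add]
    exact add_mem (hp a) (hr a)
  zero_mem' a := by simp
  smul_mem' r p hp a := by
    classical
    rw [smul_eq_mul, MvPolynomial.coeff_mul]
    refine sum_mem fun x hx => Ideal.mul_mem_left _ _ ?_
    rw [← Finset.HasAntidiagonal.mem_antidiagonal.1 hx]
    exact leadingIdeal_le_add m he I x.2 x.1 (hp x.2)

theorem monomial_mem_initialIdeal (he : IsTwistedMonomial C e) {I : Ideal S} {a : ι →₀ ℕ}
    {c : C} : MvPolynomial.monomial a c ∈ initialIdeal m he I ↔ c ∈ leadingIdeal m C e I a := by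
  classical
  refine ⟨fun h => by simpa using h a, fun hc b => ?_⟩
  rw [MvPolynomial.coeff_monomial]
  split_ifs with hab
  · exact hab ▸ hc
  · exact zero_mem _

theorem eq_zero_or_exists_leading_term {A : Set (ι →₀ ℕ)} {f : S}
    (hf : f ∈ Submodule.span C (e '' A)) :
    f = 0 ∨ ∃ a ∈ A, ∃ c : C, ∃ l ∈ lower m C e a, f = c • e a + l := by
  classical
  obtain ⟨r, hr, rfl⟩ := (Finsupp.mem_span_image_iff_linearCombination C).1 hf
  refine (eq_or_ne r 0).imp (by simp +contextual) fun hr0 => ?_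
  obtain ⟨a, ha, hmax⟩ := r.support.exists_max_image m.toSyn (Finsupp.support_nonempty_iff.2 hr0)
  refine ⟨a, hr ha, r a, Finsupp.linearCombination C e (r.erase a), ?_, ?_⟩
  · refine (Finsupp.mem_span_image_iff_linearCombination C).2 ⟨_, fun b hb => ?_, rfl⟩
    rw [Finset.mem_coe, Finsupp.support_erase, Finset.mem_erase] at hb
    exact (hmax b hb.2).lt_of_ne (m.toSyn.injective.ne hb.1)
  · rw [← Finsupp.linearCombination_single, ← map_add, Finsupp.single_add_erase]

/-- Subtracting an element of `I` with the same leading term, one descends along the well-founded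
monomial order. -/
theorem le_of_leadingIdeal_le (hspan : Submodule.span C (Set.range e) = ⊤) {I J : Ideal S}
    (hIJ : I ≤ J) (h : ∀ a, leadingIdeal m C e J a ≤ leadingIdeal m C e I a) : J ≤ I := by
  have mem_of_leading_term (a : ι →₀ ℕ) :
      ∀ (c : C), ∀ l ∈ lower m C e a, c • e a + l ∈ J → c • e a + l ∈ I := by
    induction a using (InvImage.wf m.toSyn wellFounded_lt).induction with
    | _ a ih =>
    intro c l hl hJ
    obtain ⟨g, hg, l', hl', hgl⟩ := (mem_leadingIdeal m).1 <| h a <|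
      (mem_leadingIdeal m).2 ⟨_, hJ, -l, neg_mem hl, add_neg_cancel_right _ _⟩
    rw [← hgl, add_assoc] at hJ ⊢
    have rest_mem_J : l' + l ∈ J := (J.add_mem_iff_right (hIJ hg)).1 hJ
    refine I.add_mem hg ?_
    obtain h0 | ⟨b, hb, c', l'', hl'', heq⟩ :=
      eq_zero_or_exists_leading_term m (add_mem hl' hl)
    · exact h0 ▸ I.zero_mem
    · exact heq ▸ ih b hb c' l'' hl'' (heq ▸ rest_mem_J)
  intro f hf
  obtain rfl | ⟨a, -, c, l, hl, rfl⟩ := eq_zero_or_exists_leading_term (C := C) (e := e) m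
    (A := Set.univ) (f := f) (by simp [hspan])
  · exact I.zero_mem
  · exact mem_of_leading_term a c l hl hf

theorem initialIdeal_strictMono (he : IsTwistedMonomial C e)
    (hspan : Submodule.span C (Set.range e) = ⊤) : StrictMono (initialIdeal m he) := by
  intro I J hIJ
  refine lt_of_le_not_ge (fun p hp a => leadingIdeal_mono m hIJ.le a (hp a)) fun hle => ?_
  exact hIJ.not_ge <| le_of_leadingIdeal_le m hspan hIJ.le fun a c hc =>
    (monomial_mem_initialIdeal m he).1 (hle ((monomial_mem_initialIdeal m he).2 hc))

theorem isNoetherianRing [Finite ι] [IsNoetherianRing C] (he : IsTwistedMonomial C e)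
    (hspan : Submodule.span C (Set.range e) = ⊤) : IsNoetherianRing S := by
  obtain ⟨N, ⟨f⟩⟩ := Finite.exists_equiv_fin ι
  let : LinearOrder ι := LinearOrder.lift' f f.injective
  have : WellFoundedGT (Ideal S) := (initialIdeal_strictMono .lex he hspan).wellFoundedGT
  exact isNoetherian_iff'.2 this

theorem op (he : IsTwistedMonomial C e) :
    IsTwistedMonomial C fun a => MulOpposite.op (e a) := fun a b => by
  obtain ⟨u, hu⟩ := he b a
  exact ⟨u, by rw [← MulOpposite.op_mul, hu, add_comm, MulOpposite.op_smul]⟩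

theorem isTwoSidedNoetherian [Finite ι] [IsNoetherianRing C] (he : IsTwistedMonomial C e)
    (hspan : Submodule.span C (Set.range e) = ⊤) : IsTwoSidedNoetherian S := by
  refine ⟨he.isNoetherianRing hspan, he.op.isNoetherianRing ?_⟩
  have map_span := Submodule.map_span (MulOpposite.opLinearEquiv C : S ≃ₗ[C] Sᵐᵒᵖ).toLinearMap
    (Set.range e)
  rw [hspan, Submodule.map_top, LinearEquiv.range, ← Set.range_comp] at map_span
  exact map_span.symm

end IsTwistedMonomial

theorem SkewCommute.isTwoSidedNoetherian {ι C S : Type*} [Finite ι] [CommRing C]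
    [IsNoetherianRing C] [Ring S] [Algebra C S] {p : ι → ι → Cˣ} {g : ι → S}
    (h : SkewCommute p g) (hg : Algebra.adjoin C (Set.range g) = ⊤) : IsTwoSidedNoetherian S := by
  have := Fintype.ofFinite ι
  have hL := (Finset.univ : Finset ι).nodup_toList
  have hmem (c : ι) := Finset.mem_toList.2 (Finset.mem_univ c)
  exact IsTwistedMonomial.isTwoSidedNoetherian (h.exists_orderedMonomial_mul hL hmem)
    (h.span_orderedMonomial_eq_top hg hL hmem)

theorem adjoin_range_one_tmul {ι D B : Type*} (C : Type*) [CommRing C] [CommRing D] [Ring B]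
    [Algebra D B] [Algebra D C] {g : ι → B} (hg : Algebra.adjoin D (Set.range g) = ⊤) :
    Algebra.adjoin C (Set.range fun c => (1 : C) ⊗ₜ[D] g c) = ⊤ := by
  have := Algebra.TensorProduct.adjoin_one_tmul_image_eq_top (A := C) (Set.range g) hg
  rwa [← Set.range_comp] at this

theorem SkewCommute.isStronglyNoetherian {ι D B : Type*} [Finite ι] [CommRing D] [Ring B]
    [Algebra D B] {p : ι → ι → Dˣ} {g : ι → B} (h : SkewCommute p g)
    (hg : Algebra.adjoin D (Set.range g) = ⊤) : IsStronglyNoetherian.{w} D B := by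
  intro C _ _ _
  refine SkewCommute.isTwoSidedNoetherian (C := C)
    (p := fun c c' => Units.map (algebraMap D C : D →* C) (p c c')) (fun c c' => ?_)
    (adjoin_range_one_tmul C hg)
  simp [h c c']

theorem AlgFiltration.IsAdapted.isStronglyNoetherian_gr {ι T S : Type*} [Finite ι] [CommRing T]
    [Ring S] [Algebra T S] {F : AlgFiltration T S} {p : ι → ι → Tˣ} {g : ι → S} {d : ι → ℕ}
    (hg : F.SkewCommute p g d) {L : List ι} (hL : L.Nodup) (hmem : ∀ c, c ∈ L)
    {b : Module.Basis (ι →₀ ℕ) T S} (h : F.IsAdapted b (Finsupp.weight d))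
    (hb : ∀ a, b a = orderedMonomial L g a) : IsStronglyNoetherian.{w} T F.Gr := by
  obtain ⟨e, -⟩ := h.exists_quantumAffineSpace_equiv hg hL hmem hb
  refine ((QuantumAffineSpace.skewCommute_z p).map e.toAlgHom).isStronglyNoetherian ?_
  rw [← Function.comp_def, Set.range_comp, ← AlgHom.map_adjoin, QuantumAffineSpace.adjoin_z,
    Algebra.map_top, AlgHom.range_eq_top]
  exact e.surjective

theorem AlgFiltration.IsAdapted.isCongenialVia {ι k A : Type*} [Finite ι] [Field k] [Ring A]
    [Algebra k A] {F : AlgFiltration k A} {D : Subalgebra ℤ k} {B : Subalgebra D A}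
    {p : ι → ι → Dˣ} {g : ι → B} {d : ι → ℕ} (hd : ∀ c, d c ≠ 0)
    (hg : (F.induced B).SkewCommute p g d) {L : List ι} (hL : L.Nodup) (hmem : ∀ c, c ∈ L)
    {b : Module.Basis (ι →₀ ℕ) D B} (hb : ∀ a, b a = orderedMonomial L g a)
    {b' : Module.Basis (ι →₀ ℕ) k A} (hbb' : ∀ a, (b a : A) = b' a)
    (h : F.IsAdapted b' (Finsupp.weight d)) (affine : D.FG)
    (reduction : ∀ P : Ideal D, P.IsMaximal → Finite (D ⧸ P) →
      Algebra.FiniteType (D ⧸ P) ((D ⧸ P) ⊗[D] B) ∧ IsTwoSidedNoetherian ((D ⧸ P) ⊗[D] B) ∧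
        IsPIAlgebra (D ⧸ P) ((D ⧸ P) ⊗[D] B)) :
    IsCongenialVia.{w} F D B := by
  have isAdapted_induced := h.induced Subtype.val_injective hbb'
  have finite_sublevel (m : ℕ) : {a | Finsupp.weight d a ≤ m}.Finite :=
    Finsupp.finite_of_nat_weight_le d hd m
  have isLocallyFinite_induced := isAdapted_induced.isLocallyFinite finite_sublevel
  exact
    { locallyFinite := h.isLocallyFinite finite_sublevel
      affine
      order := .of_basis Subtype.val_injective b b' _ hbb'
      order_locallyFinite := isLocallyFinite_induced
      gr_order := h.isOrder_grIncl Subtype.val_injective hbb'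
      gr_stronglyNoetherian := isAdapted_induced.isStronglyNoetherian_gr hg hL hmem hb
      gr_locallyFinite := AlgFiltration.finite_piece _ isLocallyFinite_induced
      reduction }

/-! ### Polynomial identities -/

/-- The standard polynomial of degree `m`: the alternating sum, over the permutations `σ` of the
first `m` variables, of the monomials `X_σ(0) ⋯ X_σ(m-1)`. -/
noncomputable def standardPolynomial (k : Type*) [CommRing k] (m : ℕ) : FreeAlgebra k ℕ :=
  ∑ σ : Equiv.Perm (Fin m),
    Equiv.Perm.sign σ • (List.ofFn fun i => FreeAlgebra.ι k (σ i : ℕ)).prod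

theorem lift_standardPolynomial {k A : Type*} [CommRing k] [Ring A] [Algebra k A] (m : ℕ)
    (v : ℕ → A) : FreeAlgebra.lift k v (standardPolynomial k m) =
      ∑ σ : Equiv.Perm (Fin m), Equiv.Perm.sign σ • (List.ofFn fun i => v (σ i : ℕ)).prod := by
  simp [standardPolynomial, map_sum, Units.smul_def, map_list_prod, List.map_ofFn,
    Function.comp_def]

theorem freeAlgebraBasis_ofList {k X : Type*} [CommRing k] (l : List X) :
    FreeAlgebra.basisFreeMonoid k X (FreeMonoid.ofList l) = (l.map (FreeAlgebra.ι k)).prod := by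
  simp [FreeAlgebra.basisFreeMonoid, FreeAlgebra.equivMonoidAlgebraFreeMonoid,
    FreeMonoid.lift_apply]

theorem standardPolynomial_ne_zero (k : Type*) [CommRing k] [Nontrivial k] (m : ℕ) :
    standardPolynomial k m ≠ 0 := by
  let word (σ : Equiv.Perm (Fin m)) : FreeMonoid ℕ := .ofList (List.ofFn fun i => (σ i : ℕ))
  have word_injective : Function.Injective word := fun σ τ h =>
    Equiv.ext fun i => Fin.ext (congrFun (List.ofFn_injective (FreeMonoid.ofList.injective h)) i)
  have linearIndependent :=
    (FreeAlgebra.basisFreeMonoid k ℕ).linearIndependent.comp word word_injective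
  intro h
  refine one_ne_zero (α := k) ?_
  simpa using Fintype.linearIndependent_iff.1 linearIndependent
    (fun σ => ((Equiv.Perm.sign σ : ℤ) : k))
    (by simpa [standardPolynomial, word, freeAlgebraBasis_ofList, List.map_ofFn,
      Function.comp_def, Units.smul_def, Int.cast_smul_eq_zsmul] using h) 1

theorem alternatingMap_eq_zero_of_span_eq_top {R M N : Type*} [CommRing R] [AddCommGroup M]
    [AddCommGroup N] [Module R M] [Module R N] {r m : ℕ} (hrm : r < m) {s : Fin r → M}
    (hs : Submodule.span R (Set.range s) = ⊤) (f : M [⋀^Fin m]→ₗ[R] N) : f = 0 := by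
  ext v
  choose c hc using fun i =>
    (Submodule.mem_span_range_iff_exists_fun R).1 (hs ▸ Submodule.mem_top : v i ∈ _)
  obtain rfl : (fun i => ∑ j, c i j • s j) = v := funext hc
  rw [AlternatingMap.zero_apply, ← AlternatingMap.coe_multilinearMap, MultilinearMap.map_sum]
  refine Finset.sum_eq_zero fun t _ => ?_
  obtain ⟨i, j, hij, ht⟩ := Fintype.exists_ne_map_eq_of_card_lt t (by simpa using hrm)
  rw [MultilinearMap.map_smul_univ, AlternatingMap.coe_multilinearMap,
    f.map_eq_zero_of_eq (fun i => s (t i)) (congrArg s ht) hij, smul_zero]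

theorem isPIAlgebra_of_moduleFinite {k A : Type*} (R : Type*) [CommRing k] [Nontrivial k]
    [CommRing R] [Ring A] [Algebra k A] [Algebra R A] [Module.Finite R A] : IsPIAlgebra k A := by
  obtain ⟨r, s, hs⟩ := Module.Finite.exists_fin (R := R) (M := A)
  refine ⟨standardPolynomial k (r + 1), standardPolynomial_ne_zero k _, fun v => ?_⟩
  have alternatization_eq_zero := DFunLike.congr_fun
    (alternatingMap_eq_zero_of_span_eq_top r.lt_succ_self hs
      (MultilinearMap.alternatization (MultilinearMap.mkPiAlgebraFin R (r + 1) A)))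
    fun i : Fin (r + 1) => v i
  rw [MultilinearMap.alternatization_apply] at alternatization_eq_zero
  rw [lift_standardPolynomial]
  simpa using alternatization_eq_zero

theorem isTwoSidedNoetherian_of_moduleFinite {A : Type*} (R : Type*) [CommRing R]
    [IsNoetherianRing R] [Ring A] [Algebra R A] [Module.Finite R A] : IsTwoSidedNoetherian A :=
  have : Module.Finite R Aᵐᵒᵖ := .equiv (MulOpposite.opLinearEquiv R)
  ⟨.of_finite R A, .of_finite R Aᵐᵒᵖ⟩

/-! ### Algebras with central powers of generators -/

section CentralPowers

variable {ι S : Type*} [Ring S]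

theorem orderedMonomial_eq_smul_of_algebraMap_eq_pow {R : Type*} [CommRing R] [Algebra R S]
    {g : ι → S} {N : ℕ} {r : ι → R} (hr : ∀ c, algebraMap R S (r c) = g c ^ N) (L : List ι)
    (a : ι →₀ ℕ) : orderedMonomial L g a =
      (L.map fun c => r c ^ (a c / N)).prod • (L.map fun c => g c ^ (a c % N)).prod := by
  have pow_eq_smul (c : ι) : g c ^ a c = r c ^ (a c / N) • g c ^ (a c % N) := by
    rw [Algebra.smul_def, map_pow, hr, ← pow_mul, ← pow_add, Nat.div_add_mod]
  unfold orderedMonomial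
  induction L with
  | nil => simp
  | cons c L ih =>
    simp only [List.map_cons, List.prod_cons]
    rw [ih, pow_eq_smul, smul_mul_smul_comm]

theorem moduleFinite_of_algebraMap_eq_pow {R : Type*} [CommRing R] [Algebra R S] [Finite ι]
    {g : ι → S} {N : ℕ} (hN : 0 < N) {r : ι → R} (hr : ∀ c, algebraMap R S (r c) = g c ^ N)
    {L : List ι} (hspan : Submodule.span R (Set.range (orderedMonomial L g)) = ⊤) :
    Module.Finite R S := by
  refine ⟨Submodule.fg_def.2 ⟨Set.range fun b : ι → Fin N =>
    (L.map fun c => g c ^ (b c : ℕ)).prod, Set.finite_range _, ?_⟩⟩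
  rw [eq_top_iff, ← hspan, Submodule.span_le]
  rintro _ ⟨a, rfl⟩
  rw [orderedMonomial_eq_smul_of_algebraMap_eq_pow hr]
  exact Submodule.smul_mem _ _ (Submodule.subset_span ⟨fun c => ⟨a c % N, Nat.mod_lt _ hN⟩, rfl⟩)

theorem isTwoSidedNoetherian_and_isPIAlgebra_of_pow_mem_center {k : Type*} [CommRing k]
    [Nontrivial k] [IsNoetherianRing k] [Algebra k S] [Finite ι] {g : ι → S} {N : ℕ} (hN : 0 < N)
    (hcentral : ∀ c, g c ^ N ∈ Subalgebra.center k S) {L : List ι}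
    (hspan : Submodule.span k (Set.range (orderedMonomial L g)) = ⊤) :
    IsTwoSidedNoetherian S ∧ IsPIAlgebra k S := by
  let toCenter : MvPolynomial ι k →ₐ[k] Subalgebra.center k S :=
    MvPolynomial.aeval fun c => ⟨g c ^ N, hcentral c⟩
  let : Algebra (MvPolynomial ι k) S :=
    ((Subalgebra.center k S).val.comp toCenter).toRingHom.toAlgebra' fun r s =>
      (Subalgebra.mem_center_iff.1 (toCenter r).2 s).symm
  have : IsScalarTower k (MvPolynomial ι k) S := .of_algebraMap_eq fun t =>
    (((Subalgebra.center k S).val.comp toCenter).commutes t).symm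
  have algebraMap_X (c : ι) : algebraMap (MvPolynomial ι k) S (.X c) = g c ^ N := by
    change (toCenter (.X c) : S) = _
    rw [MvPolynomial.aeval_X]
  have hspan' : Submodule.span (MvPolynomial ι k) (Set.range (orderedMonomial L g)) = ⊤ :=
    eq_top_iff.2 fun s _ =>
      Submodule.span_le_restrictScalars k (MvPolynomial ι k) _ (hspan ▸ Submodule.mem_top : s ∈ _)
  have := moduleFinite_of_algebraMap_eq_pow hN algebraMap_X hspan'
  exact ⟨isTwoSidedNoetherian_of_moduleFinite (MvPolynomial ι k),
    isPIAlgebra_of_moduleFinite (MvPolynomial ι k)⟩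

variable {T : Type*} [CommRing T] [Algebra T S] {a b z : S} {u : T}

theorem mul_pow_of_mul_eq_add_smul (h : a * b = z + u • (b * a)) (hz : Commute z b) (m : ℕ) :
    a * b ^ m = (∑ i ∈ Finset.range m, u ^ i) • (z * b ^ (m - 1)) + u ^ m • (b ^ m * a) := by
  induction m with
  | zero => simp
  | succ m ih =>
    have sum_step : (∑ i ∈ Finset.range m, u ^ i) • (z * b ^ (m - 1)) * b =
        (∑ i ∈ Finset.range m, u ^ i) • (z * b ^ m) := by
      cases m with
      | zero => simp
      | succ m => rw [smul_mul_assoc, mul_assoc, Nat.add_sub_cancel, ← pow_succ]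
    rw [pow_succ, ← mul_assoc, ih, add_mul, sum_step, smul_mul_assoc, mul_assoc _ a, h, mul_add,
      mul_smul_comm, (hz.pow_right m).eq, Finset.sum_range_succ, ← mul_assoc, ← pow_succ,
      Nat.add_sub_cancel, add_smul, smul_add, smul_smul, ← pow_succ, (hz.pow_right m).eq]
    abel

theorem commute_pow_of_mul_eq_add_smul (h : a * b = z + u • (b * a)) (hz : Commute z b) {N : ℕ}
    (hpow : u ^ N = 1) (hsum : ∑ i ∈ Finset.range N, u ^ i = 0) : Commute a (b ^ N) := by
  have := mul_pow_of_mul_eq_add_smul h hz N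
  rwa [hpow, hsum, zero_smul, zero_add, one_smul] at this

end CentralPowers

/-! ### Families that satisfy the relations of a quantized Weyl algebra -/

namespace QuantizedWeyl

variable {T S : Type*} [CommRing T] [Ring S] [Algebra T S] {n : ℕ}

/-- The relations of the quantized Weyl algebra, for a family of elements of a `T`-algebra. -/
structure Satisfies (q : Fin n → Fin n → Tˣ) (γ : Fin n → Tˣ) (g : Fin n ⊕ Fin n → S) :
    Prop where
  yy (i j : Fin n) : g (.inr i) * g (.inr j) = (q i j : T) • (g (.inr j) * g (.inr i))
  xx (i j : Fin n) (h : i < j) :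
    g (.inl i) * g (.inl j) = (γ i * q i j : T) • (g (.inl j) * g (.inl i))
  xy_lt (i j : Fin n) (h : i < j) :
    g (.inl i) * g (.inr j) = (q j i : T) • (g (.inr j) * g (.inl i))
  xy_gt (i j : Fin n) (h : j < i) :
    g (.inl i) * g (.inr j) = (γ j * q j i : T) • (g (.inr j) * g (.inl i))
  xy_eq (j : Fin n) : g (.inl j) * g (.inr j) =
    1 + (γ j : T) • (g (.inr j) * g (.inl j)) +
      ∑ l ∈ Finset.univ.filter (· < j), ((γ l : T) - 1) • (g (.inr l) * g (.inl l))

theorem satisfies_gen (q : Fin n → Fin n → Tˣ) (γ : Fin n → Tˣ) : Satisfies q γ (gen q γ) where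
  yy i j := by
    simpa [gen, freeX, freeY] using RingQuot.mkAlgHom_rel T (Rel.yy (q := q) (γ := γ) i j)
  xx i j h := by
    simpa [gen, freeX, freeY] using RingQuot.mkAlgHom_rel T (Rel.xx (q := q) (γ := γ) i j h)
  xy_lt i j h := by
    simpa [gen, freeX, freeY] using RingQuot.mkAlgHom_rel T (Rel.xy_lt (q := q) (γ := γ) i j h)
  xy_gt i j h := by
    simpa [gen, freeX, freeY] using RingQuot.mkAlgHom_rel T (Rel.xy_gt (q := q) (γ := γ) i j h)
  xy_eq j := by
    simpa [gen, freeX, freeY] using RingQuot.mkAlgHom_rel T (Rel.xy_eq (q := q) (γ := γ) j)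

/-- The units `p` such that the generators commute up to `p` and up to lower order terms. -/
def commParam (q : Fin n → Fin n → Tˣ) (γ : Fin n → Tˣ) :
    Fin n ⊕ Fin n → Fin n ⊕ Fin n → Tˣ
  | .inr i, .inr j => q i j
  | .inl i, .inl j => (if i < j then γ i else if j < i then (γ j)⁻¹ else 1) * q i j
  | .inl i, .inr j => (if i < j then 1 else γ j) * q j i
  | .inr j, .inl i => ((if i < j then 1 else γ j) * q j i)⁻¹

/-- The index `i` of the generators `xᵢ` and `yᵢ`. -/
def index (c : Fin n ⊕ Fin n) : Fin n := Sum.elim id id c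

theorem deg_eq_index_add_one (c : Fin n ⊕ Fin n) : deg c = index c + 1 := by
  cases c <;> rfl

/-- The lower order term `1 + ∑_{l < j} (γ_l - 1) y_l x_l` in the relation between `x_j` and
`y_j`. -/
def lowerTerm (γ : Fin n → Tˣ) (g : Fin n ⊕ Fin n → S) (j : Fin n) : S :=
  1 + ∑ l ∈ Finset.univ.filter (· < j), ((γ l : T) - 1) • (g (.inr l) * g (.inl l))

variable {q : Fin n → Fin n → Tˣ} {γ : Fin n → Tˣ}

theorem isMultiplicativelyAntisymmetric_commParam (hq : IsMultiplicativelyAntisymmetric q) :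
    IsMultiplicativelyAntisymmetric (commParam q γ) := by
  refine ⟨?_, ?_⟩
  · rintro (i | i) <;> simp [commParam, hq.1]
  · rintro (i | i) (j | j)
    · rcases lt_trichotomy i j with hij | rfl | hij
      · simp only [commParam, if_pos hij, if_neg hij.not_gt]
        rw [mul_mul_mul_comm, hq.2, mul_inv_cancel, one_mul]
      · simp [commParam, hq.1]
      · simp only [commParam, if_pos hij, if_neg hij.not_gt]
        rw [mul_mul_mul_comm, hq.2, inv_mul_cancel, one_mul]
    · exact mul_inv_cancel _
    · exact inv_mul_cancel _
    · exact hq.2 i j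

theorem commParam_inr_mul_commParam_inl (hq : IsMultiplicativelyAntisymmetric q)
    {c : Fin n ⊕ Fin n} {l : Fin n} (hl : l < index c) :
    commParam q γ c (.inr l) * commParam q γ c (.inl l) = 1 := by
  rcases c with j | j <;> replace hl : l < j := hl
  · simp only [commParam, if_pos hl, if_neg hl.not_gt]
    rw [mul_mul_mul_comm, hq.2, mul_inv_cancel, one_mul]
  · simp [commParam, hl]

namespace Satisfies

variable {g : Fin n ⊕ Fin n → S}

theorem map {S' : Type*} [Ring S'] [Algebra T S'] (h : Satisfies q γ g) (φ : S →ₐ[T] S') :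
    Satisfies q γ fun c => φ (g c) where
  yy i j := by simpa using congrArg φ (h.yy i j)
  xx i j hij := by simpa using congrArg φ (h.xx i j hij)
  xy_lt i j hij := by simpa using congrArg φ (h.xy_lt i j hij)
  xy_gt i j hij := by simpa using congrArg φ (h.xy_gt i j hij)
  xy_eq j := by simpa using congrArg φ (h.xy_eq j)

theorem extendScalars {C : Type*} [CommRing C] [Algebra T C] [Algebra C S] [IsScalarTower T C S]
    (h : Satisfies q γ g) :
    Satisfies (fun i j => Units.map (algebraMap T C : T →* C) (q i j))
      (fun i => Units.map (algebraMap T C : T →* C) (γ i)) g where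
  yy i j := by simpa using h.yy i j
  xx i j hij := by simpa [← map_mul] using h.xx i j hij
  xy_lt i j hij := by simpa using h.xy_lt i j hij
  xy_gt i j hij := by simpa [← map_mul] using h.xy_gt i j hij
  xy_eq j := by simpa [sub_smul] using h.xy_eq j

theorem baseChange (C : Type*) [CommRing C] [Algebra T C] (h : Satisfies q γ g) :
    Satisfies (fun i j => Units.map (algebraMap T C : T →* C) (q i j))
      (fun i => Units.map (algebraMap T C : T →* C) (γ i)) fun c => (1 : C) ⊗ₜ[T] g c :=
  (h.map (Algebra.TensorProduct.includeRight : S →ₐ[T] C ⊗[T] S)).extendScalars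

/-- The map out of a quantized Weyl algebra given by elements that satisfy its relations. -/
noncomputable def lift (h : Satisfies q γ g) : QuantizedWeyl q γ →ₐ[T] S :=
  RingQuot.liftAlgHom T ⟨FreeAlgebra.lift T g, by
    rintro _ _ (⟨i, j⟩ | ⟨i, j, hij⟩ | ⟨i, j, hij⟩ | ⟨i, j, hij⟩ | ⟨j⟩)
    · simpa [freeX, freeY] using h.yy i j
    · simpa [freeX, freeY] using h.xx i j hij
    · simpa [freeX, freeY] using h.xy_lt i j hij
    · simpa [freeX, freeY] using h.xy_gt i j hij
    · simpa [freeX, freeY] using h.xy_eq j⟩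

@[simp]
theorem lift_gen (h : Satisfies q γ g) (c : Fin n ⊕ Fin n) : h.lift (gen q γ c) = g c := by
  simp [lift, gen]

theorem mul_eq_of_index_ne (h : Satisfies q γ g) (hq : IsMultiplicativelyAntisymmetric q)
    {c c' : Fin n ⊕ Fin n} (hc : index c ≠ index c') :
    g c * g c' = (commParam q γ c c' : T) • (g c' * g c) := by
  have swap {c c' : Fin n ⊕ Fin n}
      (hcc' : g c' * g c = (commParam q γ c' c : T) • (g c * g c')) :
      g c * g c' = (commParam q γ c c' : T) • (g c' * g c) := by
    rw [hcc', smul_smul, ← Units.val_mul, (isMultiplicativelyAntisymmetric_commParam hq).2,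
      Units.val_one, one_smul]
  have xy {i j : Fin n} (hij : i ≠ j) : g (.inl i) * g (.inr j) =
      (commParam q γ (.inl i) (.inr j) : T) • (g (.inr j) * g (.inl i)) := by
    rcases hij.lt_or_gt with hlt | hlt
    · simpa [commParam, hlt] using h.xy_lt i j hlt
    · simpa [commParam, hlt.not_gt] using h.xy_gt i j hlt
  have xx {i j : Fin n} (hij : i < j) : g (.inl i) * g (.inl j) =
      (commParam q γ (.inl i) (.inl j) : T) • (g (.inl j) * g (.inl i)) := by
    simpa [commParam, hij] using h.xx i j hij
  rcases c with i | i <;> rcases c' with j | j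
  · exact (lt_or_gt_of_ne (show i ≠ j from hc)).elim xx fun hlt => swap (xx hlt)
  · exact xy hc
  · exact swap (xy (Ne.symm hc))
  · exact h.yy i j

theorem exists_mul_eq (h : Satisfies q γ g) (hq : IsMultiplicativelyAntisymmetric q)
    (c c' : Fin n ⊕ Fin n) : ∃ t : T, (t = 0 ∨ index c = index c') ∧
      g c * g c' = t • lowerTerm γ g (index c') + (commParam q γ c c' : T) • (g c' * g c) := by
  have x_mul_y (j : Fin n) : g (.inl j) * g (.inr j) =
      lowerTerm γ g j + (γ j : T) • (g (.inr j) * g (.inl j)) := by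
    rw [h.xy_eq, lowerTerm, add_right_comm]
  by_cases hc : index c = index c'
  · rcases c with i | i <;> rcases c' with j | j <;> obtain rfl : i = j := hc
    · exact ⟨0, by simp [commParam, hq.1]⟩
    · exact ⟨1, by simpa [commParam, hq.1, index] using x_mul_y i⟩
    · refine ⟨-(↑(γ i)⁻¹ : T), .inr rfl, ?_⟩
      simp [x_mul_y, commParam, hq.1, index, smul_add, smul_smul]
    · exact ⟨0, by simp [commParam, hq.1]⟩
  · exact ⟨0, by simpa using h.mul_eq_of_index_ne hq hc⟩

theorem commute_lowerTerm (h : Satisfies q γ g) (hq : IsMultiplicativelyAntisymmetric q)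
    (c : Fin n ⊕ Fin n) : Commute (lowerTerm γ g (index c)) (g c) := by
  refine .symm <| (Commute.one_right _).add_right <| .sum_right _ _ _ fun l hl => .smul_right ?_ _
  have hl : l < index c := (Finset.mem_filter.1 hl).2
  rw [commute_iff_eq, ← mul_assoc, h.mul_eq_of_index_ne hq hl.ne', smul_mul_assoc, mul_assoc,
    h.mul_eq_of_index_ne hq hl.ne', mul_smul_comm, smul_smul, ← Units.val_mul,
    commParam_inr_mul_commParam_inl hq hl, Units.val_one, one_smul, mul_assoc]

theorem skewCommute (h : Satisfies q γ g) (hq : IsMultiplicativelyAntisymmetric q)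
    {F : AlgFiltration T S} (hF : ∀ c, g c ∈ F.obj (deg c)) :
    F.SkewCommute (commParam q γ) g deg where
  mem_obj := hF
  sub_mem_below c c' := by
    obtain ⟨t, ht, hmul⟩ := h.exists_mul_eq hq c c'
    rw [hmul, add_sub_cancel_right]
    refine ht.elim (fun ht => by simp [ht]) fun hc => Submodule.smul_mem _ t ?_
    refine add_mem (F.obj_le_below (by simp [deg_eq_index_add_one]) F.one_mem)
      (sum_mem fun l hl => Submodule.smul_mem _ _ (F.obj_le_below ?_ (F.mul_mem (hF _) (hF _))))
    have hl : l < index c' := (Finset.mem_filter.1 hl).2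
    rw [deg_eq_index_add_one c, deg_eq_index_add_one c', hc]
    change l + 1 + (l + 1) < (index c' + 1 + (index c' + 1) : ℕ)
    omega

theorem commute_pow (h : Satisfies q γ g) (hq : IsMultiplicativelyAntisymmetric q) {N : ℕ}
    (hpow : ∀ u : Tˣ, (u : T) ^ N = 1) (hsum : ∀ u : Tˣ, ∑ i ∈ Finset.range N, (u : T) ^ i = 0)
    (c c' : Fin n ⊕ Fin n) : Commute (g c) (g c' ^ N) := by
  obtain ⟨t, -, hmul⟩ := h.exists_mul_eq hq c c'
  exact commute_pow_of_mul_eq_add_smul hmul ((h.commute_lowerTerm hq c').smul_left t) (hpow _)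
    (hsum _)

theorem span_orderedMonomial_eq_top (h : Satisfies q γ g)
    (hq : IsMultiplicativelyAntisymmetric q) (hg : Algebra.adjoin T (Set.range g) = ⊤)
    {L : List (Fin n ⊕ Fin n)} (hL : L.Nodup) (hmem : ∀ c, c ∈ L) :
    Submodule.span T (Set.range (orderedMonomial L g)) = ⊤ := by
  refine eq_top_iff.2 fun s _ => ?_
  obtain ⟨m, hm⟩ := (AlgFiltration.ofDegrees g deg hg).exhaustive s
  rw [AlgFiltration.ofDegrees_obj_eq_span hg
    (h.skewCommute hq (AlgFiltration.gen_mem_ofDegrees g deg hg)) hL hmem] at hm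
  exact Submodule.span_mono (Set.image_subset_range _ _) hm

end Satisfies

end QuantizedWeyl

/-! ### Reductions to finite fields -/

theorem mem_center_of_forall_commute {ι T S : Type*} [CommRing T] [Ring S] [Algebra T S]
    {g : ι → S} (hg : Algebra.adjoin T (Set.range g) = ⊤) {s : S} (h : ∀ c, Commute (g c) s) :
    s ∈ Subalgebra.center T S := by
  have adjoin_le : Algebra.adjoin T (Set.range g) ≤ Subalgebra.centralizer T {s} := by
    refine Algebra.adjoin_le (Set.range_subset_iff.2 fun c => ?_)
    rintro _ rfl
    exact (h c).symm
  rw [hg] at adjoin_le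
  exact Subalgebra.mem_center_iff.2 fun b => (adjoin_le Algebra.mem_top s rfl).symm

theorem sum_range_mul_pow_of_pow_eq_one {K : Type*} [Semiring K] {u : K} {N : ℕ} (hu : u ^ N = 1)
    (m : ℕ) : ∑ i ∈ Finset.range (N * m), u ^ i = m • ∑ i ∈ Finset.range N, u ^ i := by
  induction m with
  | zero => simp
  | succ m ih =>
    simp only [Nat.mul_succ, Finset.sum_range_add, ih, pow_add, pow_mul, hu, one_pow, one_mul,
      succ_nsmul]

theorem exists_pow_eq_one_and_geom_sum_eq_zero (K : Type*) [CommRing K] [Finite K] :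
    ∃ N : ℕ, 0 < N ∧ (∀ u : Kˣ, (u : K) ^ N = 1) ∧
      ∀ u : Kˣ, ∑ i ∈ Finset.range N, (u : K) ^ i = 0 := by
  have pow_card_units (u : Kˣ) : (u : K) ^ Nat.card Kˣ = 1 := by
    rw [← Units.val_pow_eq_pow_val, pow_card_eq_one', Units.val_one]
  refine ⟨Nat.card Kˣ * Nat.card K, Nat.mul_pos Nat.card_pos Nat.card_pos, fun u => ?_,
    fun u => ?_⟩
  · rw [pow_mul, pow_card_units, one_pow]
  · rw [sum_range_mul_pow_of_pow_eq_one (pow_card_units u), card_nsmul_eq_zero']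

namespace QuantizedWeyl.Satisfies

variable {n : ℕ}

theorem isTwoSidedNoetherian_and_isPIAlgebra {K S : Type*} [CommRing K] [Nontrivial K] [Finite K]
    [Ring S] [Algebra K S] {q : Fin n → Fin n → Kˣ} {γ : Fin n → Kˣ} {g : Fin n ⊕ Fin n → S}
    (h : Satisfies q γ g) (hq : IsMultiplicativelyAntisymmetric q)
    (hg : Algebra.adjoin K (Set.range g) = ⊤) : IsTwoSidedNoetherian S ∧ IsPIAlgebra K S := by
  obtain ⟨N, hN, hpow, hsum⟩ := exists_pow_eq_one_and_geom_sum_eq_zero K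
  exact isTwoSidedNoetherian_and_isPIAlgebra_of_pow_mem_center hN
    (fun c => mem_center_of_forall_commute hg fun c' => h.commute_pow hq hpow hsum c' c)
    (h.span_orderedMonomial_eq_top hq hg (Finset.nodup_toList Finset.univ) (by simp))

theorem reduction {D B : Type*} [CommRing D] [Ring B] [Algebra D B] {q : Fin n → Fin n → Dˣ}
    {γ : Fin n → Dˣ} {g : Fin n ⊕ Fin n → B} (h : Satisfies q γ g)
    (hq : IsMultiplicativelyAntisymmetric q) (hg : Algebra.adjoin D (Set.range g) = ⊤)
    (K : Type*) [CommRing K] [Nontrivial K] [Finite K] [Algebra D K] :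
    Algebra.FiniteType K (K ⊗[D] B) ∧ IsTwoSidedNoetherian (K ⊗[D] B) ∧
      IsPIAlgebra K (K ⊗[D] B) := by
  have adjoin_eq_top := adjoin_range_one_tmul K hg
  refine ⟨⟨Subalgebra.fg_def.2 ⟨_, Set.finite_range _, adjoin_eq_top⟩⟩, ?_⟩
  exact (h.baseChange K).isTwoSidedNoetherian_and_isPIAlgebra
    ⟨fun i => by simp only [hq.1, map_one],
      fun i j => by simp only [← map_mul, hq.2, map_one]⟩ adjoin_eq_top

end QuantizedWeyl.Satisfies

/-! ### Linear independence of ordered monomials in raising and lowering operators -/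

theorem linearIndependent_of_triangular {κ T M : Type*} [CommRing T] [AddCommGroup M] [Module T M]
    {v : κ → M} (φ : κ → M →ₗ[T] T) {r : κ → κ → Prop} (hr : WellFounded r)
    (hdiag : ∀ a, φ a (v a) ∈ nonZeroDivisors T) (hlower : ∀ a b, φ a (v b) ≠ 0 → b = a ∨ r b a) :
    LinearIndependent T v := by
  refine linearIndependent_iff.2 fun l hl => Finsupp.ext fun a => ?_
  induction a using hr.induction with
  | _ a ih =>
    have eval_eq : φ a (Finsupp.linearCombination T v l) = l a * φ a (v a) := by
      rw [Finsupp.linearCombination_apply, map_finsuppSum]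
      refine (Finsupp.sum_eq_single a (fun b _ hba => ?_) (by simp)).trans (by simp)
      by_cases hb : φ a (v b) = 0
      · rw [map_smul, hb, smul_zero]
      · rw [ih b ((hlower a b hb).resolve_left hba), Finsupp.zero_apply, zero_smul, map_zero]
    rw [hl, map_zero] at eval_eq
    exact (mul_right_mem_nonZeroDivisors_eq_zero_iff (hdiag a)).1 eval_eq.symm

section RaisingLowering

variable {ι T : Type*} [CommRing T]

theorem exists_prod_map_single_of_raising [DecidableEq ι]
    {F : ι → Module.End T ((ι →₀ ℕ) →₀ T)}
    (hF : ∀ i b, ∃ u ∈ nonZeroDivisors T, F i (.single b 1) = .single (b + .single i 1) u)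
    (w : List ι) (b : ι →₀ ℕ) : ∃ u ∈ nonZeroDivisors T,
      (w.map F).prod (.single b 1) = .single (b + Multiset.toFinsupp (w : Multiset ι)) u := by
  induction w with
  | nil => exact ⟨1, one_mem _, by simp⟩
  | cons i w ih =>
    obtain ⟨u, hu, hw⟩ := ih
    obtain ⟨v, hv, hi⟩ := hF i (b + Multiset.toFinsupp (w : Multiset ι))
    refine ⟨u * v, mul_mem hu hv, ?_⟩
    rw [List.map_cons, List.prod_cons, Module.End.mul_apply, hw, ← Finsupp.smul_single_one,
      map_smul, hi, Finsupp.smul_single, smul_eq_mul, ← Multiset.cons_coe,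
      ← Multiset.singleton_add, map_add, Multiset.toFinsupp_singleton,
      add_comm (Finsupp.single i 1), add_assoc]

theorem exists_prod_map_single_of_lowering [DecidableEq ι]
    {E : ι → Module.End T ((ι →₀ ℕ) →₀ T)}
    (hE : ∀ i b, ∃ u ∈ nonZeroDivisors T, E i (.single (b + .single i 1) 1) = .single b u)
    (w : List ι) (b : ι →₀ ℕ) : ∃ u ∈ nonZeroDivisors T,
      (w.map E).prod (.single (b + Multiset.toFinsupp (w : Multiset ι)) 1) = .single b u := by
  induction w generalizing b with
  | nil => exact ⟨1, one_mem _, by simp⟩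
  | cons i w ih =>
    obtain ⟨u, hu, hw⟩ := ih (b + .single i 1)
    obtain ⟨v, hv, hi⟩ := hE i b
    refine ⟨u * v, mul_mem hu hv, ?_⟩
    rw [List.map_cons, List.prod_cons, Module.End.mul_apply, ← Multiset.cons_coe,
      ← Multiset.singleton_add, map_add, Multiset.toFinsupp_singleton, ← add_assoc, hw,
      ← Finsupp.smul_single_one, map_smul, hi, Finsupp.smul_single, smul_eq_mul]

theorem prod_map_single_eq_zero_of_lowering [DecidableEq ι]
    {E : ι → Module.End T ((ι →₀ ℕ) →₀ T)}
    (hE : ∀ i b, ∃ u ∈ nonZeroDivisors T, E i (.single (b + .single i 1) 1) = .single b u)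
    (hE₀ : ∀ i b, b i = 0 → E i (.single b 1) = 0) (w : List ι) {b : ι →₀ ℕ}
    (hb : ¬ Multiset.toFinsupp (w : Multiset ι) ≤ b) : (w.map E).prod (.single b 1) = 0 := by
  induction w with
  | nil => simp at hb
  | cons i w ih =>
    rw [List.map_cons, List.prod_cons, Module.End.mul_apply]
    by_cases hw : Multiset.toFinsupp (w : Multiset ι) ≤ b
    · obtain ⟨b, rfl⟩ := exists_add_of_le hw
      rw [add_comm] at hb ⊢
      obtain ⟨u, -, hu⟩ := exists_prod_map_single_of_lowering hE w b
      rw [← Multiset.cons_coe, ← Multiset.singleton_add, map_add, Multiset.toFinsupp_singleton,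
        add_le_add_iff_right, Finsupp.single_le_iff, not_le, Nat.lt_one_iff] at hb
      rw [hu, ← Finsupp.smul_single_one, map_smul, hE₀ i b hb, smul_zero]
    · rw [ih hw, map_zero]

theorem toFinsupp_orderedWord [DecidableEq ι] {L : List ι} (hL : L.Nodup) (hmem : ∀ i, i ∈ L)
    (a : ι →₀ ℕ) : Multiset.toFinsupp (orderedWord L a : Multiset ι) = a := by
  rw [coe_orderedWord hL hmem, Finsupp.toMultiset_toFinsupp]

theorem orderedMonomial_map_inr_append_map_inl {κ S : Type*} [Monoid S] (L : List ι)
    (L' : List κ) (g : ι ⊕ κ → S) (a : ι ⊕ κ →₀ ℕ) :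
    orderedMonomial (L'.map .inr ++ L.map .inl) g a =
      ((orderedWord L' (Finsupp.sumFinsuppEquivProdFinsupp a).2).map fun i => g (.inr i)).prod *
        ((orderedWord L (Finsupp.sumFinsuppEquivProdFinsupp a).1).map
          fun i => g (.inl i)).prod := by
  rw [prod_map_orderedWord, prod_map_orderedWord]
  simp [orderedMonomial, Function.comp_def]

section

variable {g : ι ⊕ ι → Module.End T ((ι →₀ ℕ) →₀ T)}
  (hF : ∀ i b, ∃ u ∈ nonZeroDivisors T, g (.inr i) (.single b 1) = .single (b + .single i 1) u)
  (hE : ∀ i b, ∃ u ∈ nonZeroDivisors T, g (.inl i) (.single (b + .single i 1) 1) = .single b u)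
  (hE₀ : ∀ i b, b i = 0 → g (.inl i) (.single b 1) = 0)
  {L : List ι} (hL : L.Nodup) (hmem : ∀ i, i ∈ L)
include hE hL hmem

include hF in
theorem exists_orderedMonomial_single_of_raising_of_lowering (a : ι ⊕ ι →₀ ℕ) :
    ∃ u ∈ nonZeroDivisors T, orderedMonomial (L.map .inr ++ L.map .inl) g a
      (.single (Finsupp.sumFinsuppEquivProdFinsupp a).1 1) =
        .single (Finsupp.sumFinsuppEquivProdFinsupp a).2 u := by
  classical
  obtain ⟨u, hu, hX⟩ := exists_prod_map_single_of_lowering hE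
    (orderedWord L (Finsupp.sumFinsuppEquivProdFinsupp a).1) 0
  obtain ⟨v, hv, hY⟩ := exists_prod_map_single_of_raising hF
    (orderedWord L (Finsupp.sumFinsuppEquivProdFinsupp a).2) 0
  rw [toFinsupp_orderedWord hL hmem, zero_add] at hX hY
  refine ⟨u * v, mul_mem hu hv, ?_⟩
  rw [orderedMonomial_map_inr_append_map_inl, Module.End.mul_apply, hX, ← Finsupp.smul_single_one,
    map_smul, hY, Finsupp.smul_single, smul_eq_mul]

include hE₀ in
theorem orderedMonomial_single_eq_zero_of_lowering {a : ι ⊕ ι →₀ ℕ} {b : ι →₀ ℕ}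
    (hab : ¬ (Finsupp.sumFinsuppEquivProdFinsupp a).1 ≤ b) :
    orderedMonomial (L.map .inr ++ L.map .inl) g a (.single b 1) = 0 := by
  classical
  rw [← toFinsupp_orderedWord hL hmem (Finsupp.sumFinsuppEquivProdFinsupp a).1] at hab
  rw [orderedMonomial_map_inr_append_map_inl, Module.End.mul_apply,
    prod_map_single_eq_zero_of_lowering hE hE₀ _ hab, map_zero]

include hF hE₀ in
theorem linearIndependent_orderedMonomial_of_raising_of_lowering :
    LinearIndependent T (orderedMonomial (L.map .inr ++ L.map .inl) g) := by
  let split := Finsupp.sumFinsuppEquivProdFinsupp (α := ι) (β := ι) (γ := ℕ)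
  let coeffAt (a : ι ⊕ ι →₀ ℕ) : Module.End T ((ι →₀ ℕ) →₀ T) →ₗ[T] T :=
    Finsupp.lapply (split a).2 ∘ₗ LinearMap.applyₗ (.single (split a).1 1)
  have wf : WellFounded fun b a : ι ⊕ ι →₀ ℕ => (split b).1 < (split a).1 :=
    InvImage.wf (fun a => (split a).1) wellFounded_lt
  refine linearIndependent_of_triangular (M := Module.End T ((ι →₀ ℕ) →₀ T)) coeffAt wf
    (fun a => ?_) fun a b hab => ?_
  · obtain ⟨u, hu, h⟩ := exists_orderedMonomial_single_of_raising_of_lowering hF hE hL hmem a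
    rwa [LinearMap.comp_apply, LinearMap.applyₗ_apply_apply, h, Finsupp.lapply_apply,
      Finsupp.single_eq_same]
  · have le : (split b).1 ≤ (split a).1 := by
      by_contra hle
      refine hab ?_
      rw [LinearMap.comp_apply, LinearMap.applyₗ_apply_apply,
        orderedMonomial_single_eq_zero_of_lowering hE hE₀ hL hmem hle, map_zero]
    refine (eq_or_lt_of_le le).imp_left fun heq => split.injective (Prod.ext heq ?_)
    obtain ⟨u, -, h⟩ := exists_orderedMonomial_single_of_raising_of_lowering hF hE hL hmem b
    by_contra hne
    refine hab ?_
    rw [LinearMap.comp_apply, LinearMap.applyₗ_apply_apply, ← heq, h, Finsupp.lapply_apply,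
      Finsupp.single_eq_of_ne' hne]

end

end RaisingLowering

/-! ### The Fock representation -/

namespace QuantizedWeyl

variable {T : Type*} [CommRing T] {n : ℕ}

/-- The scalar `∏_{j < i} u_j ^ a_j` by which an operator of index `i` of the Fock representation
moves past the variables of smaller index in the monomial `t ^ a`. -/
def weight (u : Fin n → T) (i : Fin n) (a : Fin n →₀ ℕ) : T :=
  ∏ j ∈ Finset.univ.filter (· < i), u j ^ a j

theorem weight_mul (u v : Fin n → T) (i : Fin n) (a : Fin n →₀ ℕ) :
    weight (fun j => u j * v j) i a = weight u i a * weight v i a := by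
  simp only [weight, mul_pow, Finset.prod_mul_distrib]

theorem weight_add_single (u : Fin n → T) (i j : Fin n) (a : Fin n →₀ ℕ) :
    weight u i (a + .single j 1) = weight u i a * if j < i then u j else 1 := by
  simp only [weight, Finsupp.add_apply, pow_add, Finset.prod_mul_distrib, Finsupp.single_apply,
    pow_ite, pow_one, pow_zero, Finset.prod_ite_eq, Finset.mem_filter_univ]

theorem weight_eq_one_add_sum (u : Fin n → T) (i : Fin n) (a : Fin n →₀ ℕ) :
    weight u i a = 1 + ∑ l ∈ Finset.univ.filter (· < i), (u l ^ a l - 1) * weight u l a := by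
  have telescope := Finset.prod_add_ordered (Finset.univ.filter (· < i)) (fun _ => 1)
    fun l => u l ^ a l - 1
  simp only [add_sub_cancel, Finset.prod_const_one, mul_one, Finset.filter_filter] at telescope
  refine telescope.trans (congrArg _ (Finset.sum_congr rfl fun l hl => ?_))
  refine congrArg _ (Finset.prod_congr (Finset.filter_congr fun j _ => ?_) fun _ _ => rfl)
  exact and_iff_right_of_imp fun hj => hj.trans (Finset.mem_filter.1 hl).2

theorem weight_mem_nonZeroDivisors {u : Fin n → T} (hu : ∀ j, IsUnit (u j)) (i : Fin n)
    (a : Fin n →₀ ℕ) : weight u i a ∈ nonZeroDivisors T :=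
  prod_mem fun j _ => pow_mem (hu j).mem_nonZeroDivisors _

/-- The operators of the Fock representation, on the free module with basis the monomials `t ^ a`:
`y_i` multiplies by `t_i`, and `x_i` is a `γ_i`-derivative in `t_i`, both twisted by a rescaling of
the variables of smaller index. -/
noncomputable def fock (q : Fin n → Fin n → Tˣ) (γ : Fin n → Tˣ) :
    Fin n ⊕ Fin n → Module.End T ((Fin n →₀ ℕ) →₀ T)
  | .inl i => Finsupp.lsum T fun a => ((∑ s ∈ Finset.range (a i), (γ i : T) ^ s) *
      weight (fun j => (γ j * q j i : T)) i a) • Finsupp.lsingle (a - .single i 1)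
  | .inr i => Finsupp.lsum T fun a =>
      weight (fun j => (q i j : T)) i a • Finsupp.lsingle (a + .single i 1)

variable {q : Fin n → Fin n → Tˣ} {γ : Fin n → Tˣ}

theorem fock_inr_single (i : Fin n) (a : Fin n →₀ ℕ) (t : T) :
    fock q γ (.inr i) (.single a t) =
      .single (a + .single i 1) (weight (fun j => (q i j : T)) i a * t) := by
  simp [fock, -Finsupp.single_mul]

theorem fock_inl_single_of_eq_zero {i : Fin n} {a : Fin n →₀ ℕ} (ha : a i = 0) (t : T) :
    fock q γ (.inl i) (.single a t) = 0 := by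
  simp [fock, ha]

theorem fock_inl_single_add (i : Fin n) (a : Fin n →₀ ℕ) (t : T) :
    fock q γ (.inl i) (.single (a + .single i 1) t) =
      .single a ((∑ s ∈ Finset.range (a i + 1), (γ i : T) ^ s) *
        weight (fun j => (γ j * q j i : T)) i a * t) := by
  simp [fock, weight_add_single, -Finsupp.single_mul]

theorem eq_zero_or_exists_eq_add_single {ι : Type*} (a : ι →₀ ℕ) (i : ι) :
    a i = 0 ∨ ∃ b, a = b + .single i 1 := by
  refine (a i).eq_zero_or_pos.imp_right fun h => ⟨a - .single i 1, ?_⟩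
  rw [tsub_add_cancel_of_le (Finsupp.single_le_iff.2 h)]

theorem fock_xx {i j : Fin n} (h : i < j) : fock q γ (.inl i) * fock q γ (.inl j) =
    (γ i * q i j : T) • (fock q γ (.inl j) * fock q γ (.inl i)) := by
  refine Finsupp.lhom_ext fun a t => ?_
  simp only [Module.End.mul_apply, LinearMap.smul_apply]
  rcases eq_zero_or_exists_eq_add_single a j with hj | ⟨a, rfl⟩
  · rcases eq_zero_or_exists_eq_add_single a i with hi | ⟨a, rfl⟩
    · simp only [fock_inl_single_of_eq_zero hi, fock_inl_single_of_eq_zero hj, map_zero, smul_zero]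
    · have hj' : a j = 0 := by simpa [h.ne] using hj
      simp only [fock_inl_single_of_eq_zero hj, fock_inl_single_add,
        fock_inl_single_of_eq_zero hj', map_zero, smul_zero]
  · rcases eq_zero_or_exists_eq_add_single a i with hi | ⟨a, rfl⟩
    · have hi' : (a + .single j 1 : Fin n →₀ ℕ) i = 0 := by simpa [h.ne'] using hi
      simp only [fock_inl_single_of_eq_zero hi', fock_inl_single_add,
        fock_inl_single_of_eq_zero hi, map_zero, smul_zero]
    · rw [fock_inl_single_add, fock_inl_single_add, add_right_comm, fock_inl_single_add,
        fock_inl_single_add, Finsupp.smul_single, smul_eq_mul, weight_add_single,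
        weight_add_single, if_pos h, if_neg h.not_gt, Finsupp.add_apply, Finsupp.add_apply,
        Finsupp.single_eq_of_ne h.ne, Finsupp.single_eq_of_ne h.ne', add_zero, add_zero]
      congr 1
      ring

theorem fock_xy_lt {i j : Fin n} (h : i < j) : fock q γ (.inl i) * fock q γ (.inr j) =
    (q j i : T) • (fock q γ (.inr j) * fock q γ (.inl i)) := by
  refine Finsupp.lhom_ext fun a t => ?_
  simp only [Module.End.mul_apply, LinearMap.smul_apply, fock_inr_single]
  rcases eq_zero_or_exists_eq_add_single a i with hi | ⟨a, rfl⟩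
  · have hi' : (a + .single j 1 : Fin n →₀ ℕ) i = 0 := by simpa [h.ne'] using hi
    simp only [fock_inl_single_of_eq_zero hi, fock_inl_single_of_eq_zero hi', map_zero, smul_zero]
  · rw [add_right_comm, fock_inl_single_add, fock_inl_single_add, fock_inr_single,
      Finsupp.smul_single, smul_eq_mul, weight_add_single, weight_add_single, if_pos h,
      if_neg h.not_gt, Finsupp.add_apply, Finsupp.single_eq_of_ne h.ne, add_zero]
    congr 1
    ring

theorem fock_xy_gt {i j : Fin n} (h : j < i) : fock q γ (.inl i) * fock q γ (.inr j) =
    (γ j * q j i : T) • (fock q γ (.inr j) * fock q γ (.inl i)) := by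
  refine Finsupp.lhom_ext fun a t => ?_
  simp only [Module.End.mul_apply, LinearMap.smul_apply, fock_inr_single]
  rcases eq_zero_or_exists_eq_add_single a i with hi | ⟨a, rfl⟩
  · have hi' : (a + .single j 1 : Fin n →₀ ℕ) i = 0 := by simpa [h.ne] using hi
    simp only [fock_inl_single_of_eq_zero hi, fock_inl_single_of_eq_zero hi', map_zero, smul_zero]
  · rw [add_right_comm, fock_inl_single_add, fock_inl_single_add, fock_inr_single,
      Finsupp.smul_single, smul_eq_mul, weight_add_single, weight_add_single, if_pos h,
      if_neg h.not_gt, Finsupp.add_apply, Finsupp.single_eq_of_ne h.ne', add_zero]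
    congr 1
    ring

section

variable (hq : IsMultiplicativelyAntisymmetric q)
include hq

theorem val_mul_val_of_isMultiplicativelyAntisymmetric (i j : Fin n) :
    (q i j * q j i : T) = 1 := by
  rw [← Units.val_mul, hq.2, Units.val_one]

theorem fock_yy (i j : Fin n) : fock q γ (.inr i) * fock q γ (.inr j) =
    (q i j : T) • (fock q γ (.inr j) * fock q γ (.inr i)) := by
  refine Finsupp.lhom_ext fun a t => ?_
  simp only [Module.End.mul_apply, LinearMap.smul_apply, fock_inr_single, Finsupp.smul_single,
    smul_eq_mul, weight_add_single, add_right_comm a (.single j 1)]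
  congr 1
  rcases lt_trichotomy i j with h | rfl | h
  · simp only [if_pos h, if_neg h.not_gt]
    linear_combination (-weight (fun l => (q i l : T)) i a * weight (fun l => (q j l : T)) j a *
      t) * val_mul_val_of_isMultiplicativelyAntisymmetric hq i j
  · simp [hq.1]
  · simp only [if_pos h, if_neg h.not_gt]
    ring

theorem weight_mul_weight (i : Fin n) (a : Fin n →₀ ℕ) :
    weight (fun j => (γ j * q j i : T)) i a * weight (fun j => (q i j : T)) i a =
      weight (fun j => (γ j : T)) i a := by
  rw [← weight_mul]
  simp only [mul_assoc, val_mul_val_of_isMultiplicativelyAntisymmetric hq, mul_one]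

theorem fock_inl_fock_inr_single (i : Fin n) (a : Fin n →₀ ℕ) (t : T) :
    fock q γ (.inl i) (fock q γ (.inr i) (.single a t)) =
      .single a ((∑ s ∈ Finset.range (a i + 1), (γ i : T) ^ s) *
        weight (fun j => (γ j : T)) i a * t) := by
  rw [fock_inr_single, fock_inl_single_add, ← weight_mul_weight (γ := γ) hq]
  congr 1
  ring

theorem fock_inr_fock_inl_single (i : Fin n) (a : Fin n →₀ ℕ) (t : T) :
    fock q γ (.inr i) (fock q γ (.inl i) (.single a t)) =
      .single a ((∑ s ∈ Finset.range (a i), (γ i : T) ^ s) *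
        weight (fun j => (γ j : T)) i a * t) := by
  rcases eq_zero_or_exists_eq_add_single a i with hi | ⟨a, rfl⟩
  · simp [fock_inl_single_of_eq_zero hi, hi]
  · rw [fock_inl_single_add, fock_inr_single, ← weight_mul_weight (γ := γ) hq, weight_add_single,
      weight_add_single, if_neg (lt_irrefl i), if_neg (lt_irrefl i), Finsupp.add_apply,
      Finsupp.single_eq_same]
    congr 1
    ring

theorem fock_xy_eq (j : Fin n) : fock q γ (.inl j) * fock q γ (.inr j) =
    1 + (γ j : T) • (fock q γ (.inr j) * fock q γ (.inl j)) +
      ∑ l ∈ Finset.univ.filter (· < j),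
        ((γ l : T) - 1) • (fock q γ (.inr l) * fock q γ (.inl l)) := by
  refine Finsupp.lhom_ext fun a t => ?_
  simp only [Module.End.mul_apply, LinearMap.add_apply, LinearMap.smul_apply, LinearMap.sum_apply,
    Module.End.one_apply, fock_inl_fock_inr_single hq, fock_inr_fock_inl_single hq,
    Finsupp.smul_single, smul_eq_mul, ← Finsupp.single_add, ← Finsupp.single_finsetSum]
  congr 1
  have sum_eq : ∑ l ∈ Finset.univ.filter (· < j), ((γ l : T) - 1) *
      ((∑ s ∈ Finset.range (a l), (γ l : T) ^ s) * weight (fun i => (γ i : T)) l a * t) =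
        (weight (fun i => (γ i : T)) j a - 1) * t := by
    rw [weight_eq_one_add_sum _ j, add_sub_cancel_left, Finset.sum_mul]
    simp only [← mul_geom_sum, mul_assoc]
  rw [sum_eq, geom_sum_succ]
  ring

theorem satisfies_fock : Satisfies q γ (fock q γ) where
  yy := fock_yy hq
  xx _ _ := fock_xx
  xy_lt _ _ := fock_xy_lt
  xy_gt _ _ := fock_xy_gt
  xy_eq := fock_xy_eq hq

end

/-- All `x_i` and `y_i`, the `y_i` first. -/
def generators (n : ℕ) : List (Fin n ⊕ Fin n) :=
  (List.finRange n).map .inr ++ (List.finRange n).map .inl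

theorem nodup_generators : (generators n).Nodup := by
  refine ((List.nodup_finRange n).map Sum.inr_injective).append
    ((List.nodup_finRange n).map Sum.inl_injective) ?_
  simp [List.disjoint_left]

theorem mem_generators (c : Fin n ⊕ Fin n) : c ∈ generators n := by
  cases c <;> simp [generators]

theorem linearIndependent_orderedMonomial_fock
    (hγ : ∀ i m, ∑ s ∈ Finset.range (m + 1), (γ i : T) ^ s ∈ nonZeroDivisors T) :
    LinearIndependent T (orderedMonomial (generators n) (fock q γ)) := by
  refine linearIndependent_orderedMonomial_of_raising_of_lowering
    (fun i b => ⟨_, ?_, by rw [fock_inr_single, mul_one]⟩)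
    (fun i b => ⟨_, ?_, by rw [fock_inl_single_add, mul_one]⟩)
    (fun i b hb => fock_inl_single_of_eq_zero hb 1) (List.nodup_finRange n) List.mem_finRange
  · exact weight_mem_nonZeroDivisors (fun j => (q i j).isUnit) i b
  · exact mul_mem (hγ i (b i))
      (weight_mem_nonZeroDivisors (fun j => (γ j * q j i).isUnit) i b)

end QuantizedWeyl

/-! ### The Poincaré–Birkhoff–Witt basis -/

namespace QuantizedWeyl

variable {T : Type*} [CommRing T] {n : ℕ} {q : Fin n → Fin n → Tˣ} {γ : Fin n → Tˣ}

theorem linearIndependent_orderedMonomial_gen_of_geom_sum (hq : IsMultiplicativelyAntisymmetric q)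
    (hγ : ∀ i m, ∑ s ∈ Finset.range (m + 1), (γ i : T) ^ s ∈ nonZeroDivisors T) :
    LinearIndependent T (orderedMonomial (generators n) (gen q γ)) := by
  refine .of_comp (satisfies_fock (γ := γ) hq).lift.toLinearMap ?_
  simpa [Function.comp_def, map_orderedMonomial] using
    linearIndependent_orderedMonomial_fock (q := q) hγ

theorem linearIndependent_orderedMonomial_gen_map (C : Type*) [CommRing C] [Algebra T C]
    (hq : IsMultiplicativelyAntisymmetric q)
    (h : LinearIndependent T (orderedMonomial (generators n) (gen q γ))) :
    LinearIndependent C (orderedMonomial (generators n)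
      (gen (fun i j => Units.map (algebraMap T C : T →* C) (q i j))
        fun i => Units.map (algebraMap T C : T →* C) (γ i))) := by
  let basis := Module.Basis.mk h ((satisfies_gen q γ).span_orderedMonomial_eq_top hq
    (adjoin_gen q γ) nodup_generators mem_generators).ge
  let φ := ((satisfies_gen q γ).baseChange C).lift
  have map_eq_baseChange : φ ∘ orderedMonomial (generators n) (gen _ _) = basis.baseChange C := by
    ext a
    simp only [φ, Function.comp_apply, map_orderedMonomial, Satisfies.lift_gen,
      Module.Basis.baseChange_apply, basis, Module.Basis.mk_apply]
    exact (map_orderedMonomial Algebra.TensorProduct.includeRight _ _ a).symm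
  refine .of_comp φ.toLinearMap ?_
  rw [AlgHom.coe_toLinearMap, map_eq_baseChange]
  exact (basis.baseChange C).linearIndependent

open LaurentPolynomial in
theorem geom_sum_C_mul_T_mem_nonZeroDivisors (u : Tˣ) (m : ℕ) :
    ∑ s ∈ Finset.range (m + 1), (C (u : T) * LaurentPolynomial.T 1 : T[T;T⁻¹]) ^ s ∈
      nonZeroDivisors T[T;T⁻¹] := by
  let f : Polynomial T := ∑ s ∈ Finset.range (m + 1), (Polynomial.C (u : T) * Polynomial.X) ^ s
  have coeff_zero : f.coeff 0 = 1 := by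
    simp [f, Polynomial.coeff_zero_eq_eval_zero, Polynomial.eval_finsetSum, Finset.sum_range_succ']
  have mem : f ∈ nonZeroDivisors (Polynomial T) :=
    Polynomial.mem_nonzeroDivisors_of_coeff_mem 0 (coeff_zero ▸ one_mem _)
  have := IsLocalization.map_nonZeroDivisors_le (.powers (Polynomial.X : Polynomial T)) T[T;T⁻¹]
    ⟨f, mem, rfl⟩
  simpa [f] using this

open LaurentPolynomial in
theorem linearIndependent_orderedMonomial_gen (hq : IsMultiplicativelyAntisymmetric q) :
    LinearIndependent T (orderedMonomial (generators n) (gen q γ)) := by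
  let X : T[T;T⁻¹]ˣ := (isUnit_T 1).unit
  let ev : T[T;T⁻¹] →+* T := eval₂ (.id T) 1
  let _ := ev.toAlgebra
  let q' i j := Units.map (C : T →+* T[T;T⁻¹]).toMonoidHom (q i j)
  let γ' i := Units.map (C : T →+* T[T;T⁻¹]).toMonoidHom (γ i) * X
  have hq' : IsMultiplicativelyAntisymmetric q' :=
    ⟨fun i => by simp [q', hq.1], fun i j => by simp [q', ← map_mul, hq.2]⟩
  have map_q' : (fun i j => Units.map (ev : T[T;T⁻¹] →* T) (q' i j)) = q := by
    ext i j
    simp [q', ev]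
  have map_γ' : (fun i => Units.map (ev : T[T;T⁻¹] →* T) (γ' i)) = γ := by
    ext i
    simp [γ', ev, X]
  rw [← map_q', ← map_γ']
  exact linearIndependent_orderedMonomial_gen_map T hq' <|
    linearIndependent_orderedMonomial_gen_of_geom_sum hq' fun i =>
      geom_sum_C_mul_T_mem_nonZeroDivisors (γ i)

end QuantizedWeyl

/-! ### Congeniality of quantized Weyl algebras -/

namespace QuantizedWeyl

section PBW

variable {T : Type*} [CommRing T] {n : ℕ} {q : Fin n → Fin n → Tˣ} {γ : Fin n → Tˣ}

theorem skewCommute_gen (hq : IsMultiplicativelyAntisymmetric q) :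
    (filtration q γ).SkewCommute (commParam q γ) (gen q γ) deg :=
  (satisfies_gen q γ).skewCommute hq (gen_mem q γ)

/-- The Poincaré–Birkhoff–Witt basis, which consists of the monomials in which the `y_i` come
before the `x_i`. -/
noncomputable def pbwBasis (hq : IsMultiplicativelyAntisymmetric q) :
    Module.Basis (Fin n ⊕ Fin n →₀ ℕ) T (QuantizedWeyl q γ) :=
  .mk (linearIndependent_orderedMonomial_gen hq) ((satisfies_gen q γ).span_orderedMonomial_eq_top hq
    (adjoin_gen q γ) nodup_generators mem_generators).ge

theorem pbwBasis_apply (hq : IsMultiplicativelyAntisymmetric q) (a : Fin n ⊕ Fin n →₀ ℕ) :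
    pbwBasis hq a = orderedMonomial (generators n) (gen q γ) a :=
  Module.Basis.mk_apply _ _ a

theorem isAdapted_pbwBasis (hq : IsMultiplicativelyAntisymmetric q) :
    (filtration q γ).IsAdapted (pbwBasis hq) (Finsupp.weight deg) := fun m => by
  rw [funext (pbwBasis_apply hq)]
  exact AlgFiltration.ofDegrees_obj_eq_span _ (skewCommute_gen hq) nodup_generators mem_generators m

end PBW

section IntegralForm

variable {k : Type*} [Field k] {n : ℕ} {q : Fin n → Fin n → kˣ} {γ : Fin n → kˣ}

theorem fg_coeffRing : (coeffRing q γ).FG :=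
  Subalgebra.fg_def.2 ⟨_, ((Set.finite_range _).union (Set.finite_range _)).union
    (Set.finite_range _), rfl⟩

theorem q_mem_coeffRing (i j : Fin n) : (q i j : k) ∈ coeffRing q γ :=
  Algebra.subset_adjoin (.inl (.inl ⟨(i, j), rfl⟩))

variable (γ)

/-- The parameters `q_ij` as units of the coefficient ring; the inverse of `q_ij` is `q_ji`. -/
def integralQ (hq : IsMultiplicativelyAntisymmetric q) (i j : Fin n) : (coeffRing q γ)ˣ where
  val := ⟨q i j, q_mem_coeffRing i j⟩
  inv := ⟨q j i, q_mem_coeffRing j i⟩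
  val_inv := Subtype.ext (val_mul_val_of_isMultiplicativelyAntisymmetric hq i j)
  inv_val := Subtype.ext (val_mul_val_of_isMultiplicativelyAntisymmetric hq j i)

variable (q) in
/-- The parameters `γ_i` as units of the coefficient ring. -/
def integralGamma (i : Fin n) : (coeffRing q γ)ˣ where
  val := ⟨γ i, Algebra.subset_adjoin (.inl (.inr ⟨i, rfl⟩))⟩
  inv := ⟨(γ i : k)⁻¹, Algebra.subset_adjoin (.inr ⟨i, rfl⟩)⟩
  val_inv := Subtype.ext (by simp)
  inv_val := Subtype.ext (by simp)

variable (hq : IsMultiplicativelyAntisymmetric q)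

theorem isMultiplicativelyAntisymmetric_integralQ :
    IsMultiplicativelyAntisymmetric (integralQ γ hq) :=
  ⟨fun i => Units.ext (Subtype.ext (by simp [integralQ, hq.1])),
    fun i j => Units.ext (integralQ γ hq i j).val_inv⟩

theorem satisfies_integralGen :
    Satisfies (integralQ γ hq) (integralGamma q γ) (integralGen q γ) where
  yy i j := Subtype.ext ((satisfies_gen q γ).yy i j)
  xx i j h := Subtype.ext ((satisfies_gen q γ).xx i j h)
  xy_lt i j h := Subtype.ext ((satisfies_gen q γ).xy_lt i j h)
  xy_gt i j h := Subtype.ext ((satisfies_gen q γ).xy_gt i j h)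
  xy_eq j := Subtype.ext (by
    refine ((satisfies_gen q γ).xy_eq j).trans ?_
    push_cast
    rfl)

theorem adjoin_integralGen :
    Algebra.adjoin (coeffRing q γ) (Set.range (integralGen q γ)) = ⊤ := by
  have range_eq_preimage : Set.range (integralGen q γ) =
      ((↑) : integralForm q γ → QuantizedWeyl q γ) ⁻¹' Set.range (gen q γ) := by
    ext s
    simp [integralGen, Subtype.ext_iff]
  rw [range_eq_preimage]
  exact Algebra.adjoin_adjoin_coe_preimage

theorem skewCommute_integralGen :
    ((filtration q γ).induced (integralForm q γ)).SkewCommute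
      (commParam (integralQ γ hq) (integralGamma q γ)) (integralGen q γ) deg :=
  (satisfies_integralGen γ hq).skewCommute (isMultiplicativelyAntisymmetric_integralQ γ hq)
    (integralGen_mem q γ)

theorem coe_orderedMonomial_integralGen (a : Fin n ⊕ Fin n →₀ ℕ) :
    (↑(orderedMonomial (generators n) (integralGen q γ) a) : QuantizedWeyl q γ) =
      orderedMonomial (generators n) (gen q γ) a :=
  map_orderedMonomial (integralForm q γ).val _ _ a

theorem linearIndependent_orderedMonomial_integralGen (hq : IsMultiplicativelyAntisymmetric q) :
    LinearIndependent (coeffRing q γ) (orderedMonomial (generators n) (integralGen q γ)) := by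
  refine .of_comp (integralForm q γ).val.toLinearMap ?_
  rw [AlgHom.coe_toLinearMap, Function.comp_def]
  simp only [map_orderedMonomial]
  exact (linearIndependent_orderedMonomial_gen hq).restrict_scalars
    (by simp [Subalgebra.smul_def])

/-- The Poincaré–Birkhoff–Witt basis of the integral form. -/
noncomputable def integralBasis :
    Module.Basis (Fin n ⊕ Fin n →₀ ℕ) (coeffRing q γ) (integralForm q γ) :=
  .mk (linearIndependent_orderedMonomial_integralGen γ hq)
    ((satisfies_integralGen γ hq).span_orderedMonomial_eq_top
      (isMultiplicativelyAntisymmetric_integralQ γ hq) (adjoin_integralGen γ) nodup_generators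
      mem_generators).ge

theorem integralBasis_apply (a : Fin n ⊕ Fin n →₀ ℕ) :
    integralBasis γ hq a = orderedMonomial (generators n) (integralGen q γ) a :=
  Module.Basis.mk_apply _ _ a

theorem coe_integralBasis (a : Fin n ⊕ Fin n →₀ ℕ) :
    (integralBasis γ hq a : QuantizedWeyl q γ) = pbwBasis hq a := by
  rw [integralBasis_apply, coe_orderedMonomial_integralGen, pbwBasis_apply]

theorem isAdapted_integralBasis :
    ((filtration q γ).induced (integralForm q γ)).IsAdapted (integralBasis γ hq)
      (Finsupp.weight deg) :=
  (isAdapted_pbwBasis hq).induced Subtype.val_injective (coe_integralBasis γ hq)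

theorem isCongenialVia_integralForm (hq : IsMultiplicativelyAntisymmetric q) :
    IsCongenialVia.{w} (filtration q γ) (coeffRing q γ) (integralForm q γ) :=
  (isAdapted_pbwBasis hq).isCongenialVia (fun c => by simp [deg_eq_index_add_one])
    (skewCommute_integralGen γ hq) nodup_generators mem_generators (integralBasis_apply γ hq)
    (coe_integralBasis γ hq) fg_coeffRing fun P hP _ =>
      have := Ideal.Quotient.nontrivial_iff.2 hP.ne_top
      (satisfies_integralGen γ hq).reduction (isMultiplicativelyAntisymmetric_integralQ γ hq)
        (adjoin_integralGen γ) (coeffRing q γ ⧸ P)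

theorem exists_quantumAffineSpace_equiv_induced :
    ∃ e : QuantumAffineSpace (commParam (integralQ γ hq) (integralGamma q γ)) ≃ₐ[coeffRing q γ]
        ((filtration q γ).induced (integralForm q γ)).Gr,
      ∀ c, e (QuantumAffineSpace.z _ c) = ((filtration q γ).induced (integralForm q γ)).symbol
        (deg c) (integralGen q γ c) (integralGen_mem q γ c) :=
  (isAdapted_integralBasis γ hq).exists_quantumAffineSpace_equiv (skewCommute_integralGen γ hq)
    nodup_generators mem_generators (integralBasis_apply γ hq)

theorem exists_quantumAffineSpace_equiv :
    ∃ e : QuantumAffineSpace (fun c c' =>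
        Units.map (algebraMap (coeffRing q γ) k : coeffRing q γ →* k)
          (commParam (integralQ γ hq) (integralGamma q γ) c c')) ≃ₐ[k] (filtration q γ).Gr,
      ∀ c, e (QuantumAffineSpace.z _ c) =
        (filtration q γ).symbol (deg c) (gen q γ c) (gen_mem q γ c) :=
  (isAdapted_pbwBasis hq).exists_quantumAffineSpace_equiv
    (skewCommute_integralGen γ hq).of_induced nodup_generators mem_generators (pbwBasis_apply hq)

end IntegralForm

end QuantizedWeyl

theorem mainTheorem6 {k : Type*} [Field k] (n : ℕ)
    (q : Fin n → Fin n → kˣ) (γ : Fin n → kˣ)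
    (hq_diag : ∀ i, q i i = 1) (hq : ∀ i j, i ≠ j → q i j * q j i = 1) :
    -- The filtered algebra is congenial,
    IsCongenial.{w} (QuantizedWeyl.filtration q γ) ∧
    -- by means of its integral form; in particular the reductions of the latter are PI.
    IsCongenialVia.{w} (QuantizedWeyl.filtration q γ) (QuantizedWeyl.coeffRing q γ)
      (QuantizedWeyl.integralForm q γ) ∧
    -- The associated graded rings of the algebra and of its integral form are quantum affine
    -- spaces on the symbols of the generators, with the same parameters.
    ∃ p : (Fin n ⊕ Fin n) → (Fin n ⊕ Fin n) → (QuantizedWeyl.coeffRing q γ)ˣ,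
      IsMultiplicativelyAntisymmetric p ∧
      (∃ e : QuantumAffineSpace p ≃ₐ[QuantizedWeyl.coeffRing q γ]
            ((QuantizedWeyl.filtration q γ).induced (QuantizedWeyl.integralForm q γ)).Gr,
        ∀ c, e (QuantumAffineSpace.z p c) =
          ((QuantizedWeyl.filtration q γ).induced (QuantizedWeyl.integralForm q γ)).symbol
            (QuantizedWeyl.deg c) (QuantizedWeyl.integralGen q γ c)
            (QuantizedWeyl.integralGen_mem q γ c)) ∧
      (∃ e : QuantumAffineSpace (fun c d =>
            Units.map (algebraMap (QuantizedWeyl.coeffRing q γ) k : _ →* k) (p c d)) ≃ₐ[k]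
            (QuantizedWeyl.filtration q γ).Gr,
        ∀ c, e (QuantumAffineSpace.z _ c) =
          (QuantizedWeyl.filtration q γ).symbol (QuantizedWeyl.deg c) (QuantizedWeyl.gen q γ c)
            (QuantizedWeyl.gen_mem q γ c)) := by
  have hqq : IsMultiplicativelyAntisymmetric q := ⟨hq_diag, fun i j =>
    (eq_or_ne i j).elim (fun hij => by rw [hij, hq_diag, one_mul]) (hq i j)⟩
  have hvia := QuantizedWeyl.isCongenialVia_integralForm γ hqq
  exact ⟨⟨_, _, hvia⟩, hvia, _,
    QuantizedWeyl.isMultiplicativelyAntisymmetric_commParam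
      (QuantizedWeyl.isMultiplicativelyAntisymmetric_integralQ γ hqq),
    QuantizedWeyl.exists_quantumAffineSpace_equiv_induced γ hqq,
    QuantizedWeyl.exists_quantumAffineSpace_equiv γ hqq⟩
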